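/- Let $m\ge 1$, $\lambda_d,\mu,P_d>0$, $\alpha_d>2$, $\sigma_d^2\ge 0$, $t\ge 0$, $\omega_d\in\mathbb R$ and $\delta_d^2\ge 0$. Base stations form a homogeneous Poisson point process $\{X_i\}$ on $\mathbb R$ with intensity $\lambda_d$, and the typical vehicle is at the origin. Station $i$ has a log-normal shadowing gain $\chi_i$, $10\log_{10}\chi_i\sim N(\omega_d,\delta_d^2)$, and is moved to $Y_i=\chi_i^{-1/\alpha_d}X_i$. Put $$\lambda_D=\mathbb E[\chi^{1/\alpha_d}]\,\lambda_d=\exp\Big(\frac{\omega_d\ln 10}{10\alpha_d}+\frac12\Big(\frac{\delta_d\ln 10}{10\alpha_d}\Big)^2\Big)\lambda_d .$$ Let $x_1<x_2<\cdots$ be the ordered distances $|Y_i|$. The $m$ nearest (moved) stations cooperate; their joint signal has a Rayleigh power gain $g$, common to the $m$ stations, and every other station $i$ interferes with its own Rayleigh power gain $g_i$. All of $g,g_1,g_2,\dots$ are exponential with rate $\mu$ (mean $1/\mu$), and $g$, the $g_i$, the $\chi_i$ and the process $\{X_i\}$ are independent. Let $$I_D=\sum_{i\ \text{not cooperating}}P_d\,g_i\,|Y_i|^{-\alpha_d},\qquad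 \mathrm{SINR}_D=\frac{\sum_{i=1}^m P_d\,g\,x_i^{-\alpha_d}}{I_D+\sigma_d^2}.$$ Then $I_D<\infty$ almost surely, and the coverage probability is $$\mathbb P(\mathrm{SINR}_D>t)=\int_{0<x_1<\cdots<x_m<\infty}\zeta_{I_D}(j)\,e^{-j\sigma_d^2}\,f(x_1,\dots,x_m)\,dx_1\cdots dx_m,\qquad j=\frac{\mu t}{\sum_{i=1}^m P_d x_i^{-\alpha_d}},$$ where the integrand is integrable, $f(x_1,\dots,x_m)=(2\lambda_D)^m e^{-2\lambda_D x_m}$ on $0<x_1<\cdots<x_m$ is the joint density of the $m$ smallest distances, and $\zeta_{I_D}(s)=\mathbb E[e^{-sI_D}\mid x_1,\dots,x_m]$ is the Laplace transform of the interference given these distances, which for almost every $(x_1,\dots,x_m)$ in this region and all $s\ge 0$ equals $$\zeta_{I_D}(s)=\exp\Big[-2\lambda_D\int_{x_m}^\infty\Big(1-\frac{\mu}{sP_dx^{-\alpha_d}+\mu}\Big)dx\Big].$$ -/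

import Mathlib

open MeasureTheory ProbabilityTheory
open scoped ENNReal NNReal

namespace CV2X

variable {Ω : Type*} [MeasurableSpace Ω]

/-- Number (possibly infinite) of points of the sequence `X` that lie in `A`. -/
noncomputable def count (X : ℕ → Ω → ℝ) (A : Set ℝ) (ω : Ω) : ℕ∞ :=
  {i : ℕ | X i ω ∈ A}.encard

/-- The points `X 0, X 1, …` (listed in an arbitrary way) form a homogeneous Poisson point process
on the real line with intensity `lam`. -/
structure IsPoissonProcess (P : Measure Ω) (lam : ℝ) (X : ℕ → Ω → ℝ) : Prop where
  measurable : ∀ i, Measurable (X i)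
  law : ∀ A : Set ℝ, MeasurableSet A → volume A < ∞ →
    HasLaw (count X A)
      ((poissonMeasure (lam * volume.real A).toNNReal).map (fun n : ℕ => (n : ℕ∞))) P
  indep : ∀ (n : ℕ) (A : Fin n → Set ℝ), (∀ k, MeasurableSet (A k)) →
    (∀ k l, k ≠ l → Disjoint (A k) (A l)) → iIndepFun (fun k => count X (A k)) P

/-- The random ingredients of the downlink seen from the typical vehicle at the origin:
* base stations `X i`, a Poisson process of intensity `lamd`;
* shadowing `chi i` of station `i`, i.i.d. log-normal, `10 log₁₀ (chi i) ∼ N(w, v)`;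
* Rayleigh power gain `G i` of station `i` when it interferes, i.i.d. exponential of rate `mu`;
* Rayleigh power gain `g` of the jointly transmitted useful signal, exponential of rate `mu`;
all of these being independent. -/
structure IsDownlink (P : Measure Ω) (lamd mu w : ℝ) (v : ℝ≥0)
    (X chi G : ℕ → Ω → ℝ) (g : Ω → ℝ) : Prop where
  poisson : IsPoissonProcess P lamd X
  chi_measurable : ∀ i, Measurable (chi i)
  chi_pos : ∀ i, ∀ᵐ ω ∂P, 0 < chi i ω
  chi_law : ∀ i, HasLaw (fun ω => 10 * Real.logb 10 (chi i ω)) (gaussianReal w v) P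
  chi_indep : iIndepFun chi P
  G_measurable : ∀ i, Measurable (G i)
  G_law : ∀ i, HasLaw (G i) (expMeasure mu) P
  G_indep : iIndepFun G P
  g_measurable : Measurable g
  g_law : HasLaw g (expMeasure mu) P
  indep_X : IndepFun (fun ω i => X i ω)
    (fun ω => ((fun i => chi i ω), (fun i => G i ω), g ω)) P
  indep_chi : IndepFun (fun ω i => chi i ω) (fun ω => ((fun i => G i ω), g ω)) P
  indep_G : IndepFun (fun ω i => G i ω) g P

/-- Displaced position `chi^(-1/alpha) x` of station `i`, which absorbs its shadowing. -/
noncomputable def displaced (alpha : ℝ) (X chi : ℕ → Ω → ℝ) (i : ℕ) (ω : Ω) : ℝ :=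
  chi i ω ^ (-(1 / alpha)) * X i ω

/-- Intensity of the displaced process, `lamD = E[chi^(1/alpha)] * lamd` in closed form. -/
noncomputable def lamD (lamd alpha w : ℝ) (v : ℝ≥0) : ℝ :=
  Real.exp (w * Real.log 10 / (10 * alpha)
    + (1 / 2) * (v : ℝ) * (Real.log 10 / (10 * alpha)) ^ 2) * lamd

/-- Distance from the origin to its `(k+1)`-st nearest point among `Y 0, Y 1, …`. -/
noncomputable def nthDist (Y : ℕ → Ω → ℝ) (k : ℕ) (ω : Ω) : ℝ :=
  sInf {r : ℝ | 0 ≤ r ∧ ((k + 1 : ℕ) : ℕ∞) ≤ {i : ℕ | |Y i ω| ≤ r}.encard}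

/-- The vector `(x_1, …, x_m)` of the `m` smallest distances. -/
noncomputable def dists (Y : ℕ → Ω → ℝ) (m : ℕ) (ω : Ω) : Fin m → ℝ :=
  fun k => nthDist Y k ω

/-- Indices of the cooperating stations: those with fewer than `m` strictly nearer stations. -/
def cooperating (Y : ℕ → Ω → ℝ) (m : ℕ) (ω : Ω) : Set ℕ :=
  {i | {k : ℕ | |Y k ω| < |Y i ω|}.encard < (m : ℕ∞)}

/-- Aggregate interference from all stations outside the cooperating set, as an extended
nonnegative number. -/
noncomputable def interference (Pd alpha : ℝ) (Y G : ℕ → Ω → ℝ) (m : ℕ) (ω : Ω) : ℝ≥0∞ :=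
  ∑' i : ((cooperating Y m ω)ᶜ : Set ℕ), ENNReal.ofReal (Pd * G i ω * |Y i ω| ^ (-alpha))

/-- The downlink SINR with `m` cooperating stations and noise power `sig2`. -/
noncomputable def sinr (Pd alpha sig2 : ℝ) (Y G : ℕ → Ω → ℝ) (g : Ω → ℝ) (m : ℕ) (ω : Ω) :
    ℝ≥0∞ :=
  ENNReal.ofReal (∑ k : Fin m, Pd * g ω * dists Y m ω k ^ (-alpha)) /
    (interference Pd alpha Y G m ω + ENNReal.ofReal sig2)

/-- The region `0 < x_1 < ⋯ < x_m`. -/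
def orderedRegion (m : ℕ) : Set (Fin m → ℝ) :=
  {x | (∀ k, 0 < x k) ∧ StrictMono x}

/-- The joint distance density, `r` being the largest of the `m` distances. -/
noncomputable def jointDensity (lam : ℝ) (m : ℕ) (r : ℝ) : ℝ :=
  (2 * lam) ^ m * Real.exp (-(2 * lam * r))

/-- The argument `mu t / ∑ Pd x_i^(-alpha)`. -/
noncomputable def jArg (mu t Pd alpha : ℝ) {m : ℕ} (x : Fin m → ℝ) : ℝ :=
  mu * t / ∑ k, Pd * x k ^ (-alpha)

/-- Closed form of the Laplace transform at `s` of the interference from beyond distance `r`. -/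
noncomputable def zeta (lam mu Pd alpha s r : ℝ) : ℝ :=
  Real.exp (-(2 * lam * ∫ x in Set.Ioi r, (1 - mu / (s * Pd * x ^ (-alpha) + mu))))

end CV2X

/-!
Moving the stations and forgetting signs keeps the process Poisson: the Laplace functional of the
marked process `(X i, χ i, G i)`, pushed through `(x, c) ↦ |c ^ (-1/α) x|`, is that of a Poisson
process of intensity `2 λ_D dr ⊗ Exp(μ)` on the half-line, because scaling by `c` multiplies
Lebesgue measure by `c ^ (1/α)`, whose mean turns `λ_d` into `λ_D`.

Given its `k` smallest radii, the points of such a process beyond the `k`-th one are again Poisson.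
This strong Markov property is proved by induction on `k`: round the `(k+1)`-st radius up to a grid
point; the event that it falls in a given grid cell is the difference of two gap events, to which
the Laplace functional applies, and the mesh tends to `0`. Hence the spacings are exponential with
rate `2 λ_D`, which is the density `f`, and the interference beyond `x_m` has the conditional
Laplace transform `ζ`. As `s → 0` it tends to `1`, so the interference is finite.

Finally `SINR > t` means `g > (j / μ) (I + σ²)`, and the independent exponential gain turns this
into `exp (-j (I + σ²))`; conditioning on the distances gives the integrand.
-/

namespace CV2X

open Filter Topology Set Function

/-! ### The exponential `x ↦ exp (-x)` on `[0, ∞]` -/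

/-- The function `x ↦ exp (-x)` on `[0, ∞]`, with value `0` at `∞`, in terms of which Laplace
transforms of extended nonnegative random variables are written. -/
noncomputable def expNeg (x : ℝ≥0∞) : ℝ≥0∞ := EReal.exp (-(x : EReal))

@[simp] lemma expNeg_zero : expNeg 0 = 1 := by simp [expNeg]

@[simp] lemma expNeg_top : expNeg ∞ = 0 := by simp [expNeg]

lemma continuous_expNeg : Continuous expNeg :=
  ENNReal.continuous_exp.comp (continuous_neg.comp continuous_coe_ennreal_ereal)

@[fun_prop] lemma measurable_expNeg : Measurable expNeg := continuous_expNeg.measurable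

lemma antitone_expNeg : Antitone expNeg := fun a b h =>
  EReal.exp_monotone (EReal.neg_le_neg_iff.2 (by exact_mod_cast h))

lemma expNeg_le_one (x : ℝ≥0∞) : expNeg x ≤ 1 := by
  simpa using antitone_expNeg (zero_le (a := x))

lemma expNeg_ne_top (x : ℝ≥0∞) : expNeg x ≠ ∞ :=
  ne_top_of_le_ne_top ENNReal.one_ne_top (expNeg_le_one x)

lemma expNeg_eq_one_iff {x : ℝ≥0∞} : expNeg x = 1 ↔ x = 0 := by
  rw [expNeg, ← EReal.exp_zero, EReal.exp_strictMono.injective.eq_iff, EReal.neg_eq_zero_iff,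
    EReal.coe_ennreal_eq_zero]

lemma expNeg_ofReal {x : ℝ} (hx : 0 ≤ x) :
    expNeg (ENNReal.ofReal x) = ENNReal.ofReal (Real.exp (-x)) := by
  rw [expNeg, EReal.coe_ennreal_ofReal, max_eq_left hx, ← EReal.coe_neg, EReal.exp_coe]

lemma expNeg_add (x y : ℝ≥0∞) : expNeg (x + y) = expNeg x * expNeg y := by
  rw [expNeg, expNeg, expNeg, ← EReal.exp_add, EReal.coe_ennreal_add,
    EReal.neg_add (Or.inl (by simp)) (Or.inr (by simp)), sub_eq_add_neg]

lemma expNeg_sum {ι : Type*} (s : Finset ι) (f : ι → ℝ≥0∞) :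
    expNeg (∑ i ∈ s, f i) = ∏ i ∈ s, expNeg (f i) := by
  classical
  induction s using Finset.induction_on with
  | empty => simp
  | insert a s ha ih => rw [Finset.sum_insert ha, Finset.prod_insert ha, expNeg_add, ih]

lemma expNeg_mul_natCast (x : ℝ≥0∞) (n : ℕ) : expNeg (x * n) = expNeg x ^ n := by
  simpa [mul_comm] using expNeg_sum (Finset.range n) fun _ => x

/-- The inverse `y ↦ -log y` of `expNeg` on `[0, 1]`. -/
noncomputable def negLog (y : ℝ≥0∞) : ℝ≥0∞ := (-(ENNReal.log y)).toENNReal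

lemma measurable_negLog : Measurable negLog :=
  measurable_ereal_toENNReal.comp (measurable_neg.comp ENNReal.measurable_log)

lemma expNeg_negLog {y : ℝ≥0∞} (hy : y ≤ 1) : expNeg (negLog y) = y := by
  have hlog : ENNReal.log y ≤ 0 := ENNReal.log_one ▸ ENNReal.log_monotone hy
  rw [expNeg, negLog, EReal.coe_toENNReal (EReal.le_neg_of_le_neg (by simpa using hlog)), neg_neg,
    ENNReal.exp_log]

lemma lintegral_expNeg_le_one {α : Type*} [MeasurableSpace α] {μ : Measure α}
    [IsProbabilityMeasure μ] (f : α → ℝ≥0∞) : ∫⁻ x, expNeg (f x) ∂μ ≤ 1 := by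
  simpa using lintegral_mono (μ := μ) fun x => expNeg_le_one (f x)

lemma tendsto_lintegral_expNeg {α : Type*} [MeasurableSpace α] {μ : Measure α} [IsFiniteMeasure μ]
    {f : ℕ → α → ℝ≥0∞} {g : α → ℝ≥0∞} (hf : ∀ n, Measurable (f n))
    (hlim : ∀ x, Tendsto (fun n => f n x) atTop (𝓝 (g x))) :
    Tendsto (fun n => ∫⁻ x, expNeg (f n x) ∂μ) atTop (𝓝 (∫⁻ x, expNeg (g x) ∂μ)) :=
  tendsto_lintegral_of_dominated_convergence (fun _ => 1)
    (fun n => measurable_expNeg.comp (hf n)) (fun _ => ae_of_all _ fun _ => expNeg_le_one _)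
    (by simp) (ae_of_all _ fun x => (continuous_expNeg.tendsto _).comp (hlim x))

lemma tendsto_lintegral_one_sub_expNeg {α : Type*} [MeasurableSpace α] {μ : Measure α}
    {f : ℕ → α → ℝ≥0∞} {g : α → ℝ≥0∞} (hf : ∀ n, Measurable (f n))
    (hmono : ∀ x, Monotone fun n => f n x)
    (hlim : ∀ x, Tendsto (fun n => f n x) atTop (𝓝 (g x))) :
    Tendsto (fun n => ∫⁻ x, (1 - expNeg (f n x)) ∂μ) atTop (𝓝 (∫⁻ x, (1 - expNeg (g x)) ∂μ)) :=
  lintegral_tendsto_of_tendsto_of_monotone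
    (fun n => (measurable_const.sub (measurable_expNeg.comp (hf n))).aemeasurable)
    (ae_of_all _ fun x _ _ h => tsub_le_tsub_left (antitone_expNeg (hmono x h)) _)
    (ae_of_all _ fun x => ENNReal.Tendsto.sub tendsto_const_nhds
      ((continuous_expNeg.tendsto _).comp (hlim x)) (Or.inl ENNReal.one_ne_top))

lemma tendsto_tsum_of_monotone {ι : Type*} {f : ℕ → ι → ℝ≥0∞} {g : ι → ℝ≥0∞}
    (hmono : ∀ i, Monotone fun n => f n i) (hlim : ∀ i, Tendsto (fun n => f n i) atTop (𝓝 (g i))) :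
    Tendsto (fun n => ∑' i, f n i) atTop (𝓝 (∑' i, g i)) := by
  let _ : MeasurableSpace ι := ⊤
  simp_rw [← lintegral_count]
  exact lintegral_tendsto_of_tendsto_of_monotone (fun n => Measurable.of_discrete.aemeasurable)
    (ae_of_all _ hmono) (ae_of_all _ hlim)

/-! ### The Laplace functional of a Poisson process -/

lemma lintegral_pow_poissonMeasure (θ : ℝ≥0) {z : ℝ≥0∞} (hz : z ≤ 1) :
    ∫⁻ n, z ^ n ∂poissonMeasure θ = expNeg (θ * (1 - z)) := by
  lift z to ℝ≥0 using ne_top_of_le_ne_top ENNReal.one_ne_top hz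
  replace hz : (z : ℝ) ≤ 1 := by exact_mod_cast hz
  have hterm (n : ℕ) : (z : ℝ≥0∞) ^ n * poissonMeasure θ {n}
      = ENNReal.ofReal (Real.exp (-θ) * ((θ * z : ℝ) ^ n / n.factorial)) := by
    rw [poissonMeasure_singleton, ← ENNReal.ofReal_coe_nnreal, ← ENNReal.ofReal_pow z.coe_nonneg,
      ← ENNReal.ofReal_mul (by positivity)]
    congr 1
    ring
  have hsum : HasSum (fun n : ℕ => Real.exp (-θ) * ((θ * z : ℝ) ^ n / n.factorial))
      (Real.exp (-θ) * Real.exp (θ * z)) := by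
    have hexp := NormedSpace.expSeries_div_hasSum_exp (θ * z : ℝ)
    rw [← Real.exp_eq_exp_ℝ] at hexp
    exact hexp.mul_left _
  rw [lintegral_countable', tsum_congr hterm,
    ← ENNReal.ofReal_tsum_of_nonneg (fun n => by positivity) hsum.summable, hsum.tsum_eq,
    ← ENNReal.ofReal_coe_nnreal, ← ENNReal.ofReal_coe_nnreal, ← ENNReal.ofReal_one,
    ← ENNReal.ofReal_sub _ z.coe_nonneg, ← ENNReal.ofReal_mul θ.coe_nonneg,
    expNeg_ofReal (mul_nonneg θ.coe_nonneg (by linarith)), ← Real.exp_add]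
  congr 2
  ring

lemma tsum_simpleFunc_eq_sum_encard {α : Type*} [MeasurableSpace α] (x : ℕ → α)
    (s : SimpleFunc α ℝ≥0∞) :
    ∑' i, s (x i) = ∑ y ∈ s.range, y * ({i | x i ∈ s ⁻¹' {y}}.encard : ℝ≥0∞) := by
  rw [← lintegral_count, ← lintegral_map (f := s) s.measurable Measurable.of_discrete,
    SimpleFunc.lintegral_eq_lintegral, SimpleFunc.lintegral]
  refine Finset.sum_congr rfl fun y _ => ?_
  rw [Measure.map_apply Measurable.of_discrete (s.measurableSet_fiber y),
    Measure.count_apply .of_discrete]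
  rfl

lemma measurable_encard_setOf {Ω ι : Type*} [MeasurableSpace Ω] [Countable ι] {p : ι → Ω → Prop}
    (hp : ∀ i, MeasurableSet {ω | p i ω}) : Measurable fun ω => {i | p i ω}.encard :=
  measurable_encard.comp (measurable_set_iff.2 fun i => measurable_mem.2 (hp i))

lemma exists_simpleFunc_tendsto {α : Type*} [MeasurableSpace α] (μ : Measure α) [SigmaFinite μ]
    {ψ : α → ℝ≥0∞} (hψ : Measurable ψ) :
    ∃ s : ℕ → SimpleFunc α ℝ≥0∞, (∀ x, Monotone fun n => s n x) ∧
      (∀ x, Tendsto (fun n => s n x) atTop (𝓝 (ψ x))) ∧ ∀ n, (s n).FinMeasSupp μ := by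
  have happ (n : ℕ) (x : α) : (SimpleFunc.eapprox ψ n).restrict (spanningSets μ n) x
      = (spanningSets μ n).indicator (SimpleFunc.eapprox ψ n) x := by
    rw [SimpleFunc.restrict_apply _ (measurableSet_spanningSets μ n)]
  refine ⟨fun n => (SimpleFunc.eapprox ψ n).restrict (spanningSets μ n), fun x n n' hn => ?_,
    fun x => ?_, fun n => ?_⟩
  · simp only [happ]
    exact (indicator_le_indicator (SimpleFunc.monotone_eapprox ψ hn x)).trans
      (indicator_le_indicator_of_subset (monotone_spanningSets μ hn) (fun _ => zero_le) x)
  · have hlim : Tendsto (fun n => SimpleFunc.eapprox ψ n x) atTop (𝓝 (ψ x)) := by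
      rw [← SimpleFunc.iSup_eapprox_apply hψ x]
      exact tendsto_atTop_iSup fun n n' h => SimpleFunc.monotone_eapprox ψ h x
    refine hlim.congr' ?_
    filter_upwards [eventually_ge_atTop (spanningSetsIndex μ x)] with n hn
    rw [happ, indicator_of_mem
      (monotone_spanningSets μ hn (mem_spanningSetsIndex μ x))]
  · refine SimpleFunc.finMeasSupp_iff_support.2
      ((measure_mono fun x hx => ?_).trans_lt (measure_spanningSets_lt_top μ n))
    by_contra hxn
    exact hx (by rw [happ, indicator_of_notMem hxn])

namespace IsPoissonProcess

variable {Ω : Type*} [MeasurableSpace Ω] {P : Measure Ω} {lam : ℝ} {X : ℕ → Ω → ℝ}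

lemma measurable_count (hX : IsPoissonProcess P lam X) {A : Set ℝ} (hA : MeasurableSet A) :
    Measurable (count X A) :=
  measurable_encard_setOf fun i => hX.measurable i hA

lemma lintegral_expNeg_mul_count (hX : IsPoissonProcess P lam X) (hlam : 0 ≤ lam) {A : Set ℝ}
    (hA : MeasurableSet A) (hAfin : volume A < ∞) (y : ℝ≥0∞) :
    ∫⁻ ω, expNeg (y * (count X A ω : ℝ≥0∞)) ∂P
      = expNeg (ENNReal.ofReal lam * ((1 - expNeg y) * volume A)) := by
  have hmean : (((lam * volume.real A).toNNReal : ℝ≥0) : ℝ≥0∞)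
      = ENNReal.ofReal lam * volume A := by
    change ENNReal.ofReal (lam * volume.real A) = _
    rw [ENNReal.ofReal_mul hlam, measureReal_def, ENNReal.ofReal_toReal hAfin.ne]
  rw [(hX.law A hA hAfin).lintegral_comp (f := fun n : ℕ∞ => expNeg (y * (n : ℝ≥0∞)))
    Measurable.of_discrete.aemeasurable, lintegral_map Measurable.of_discrete .of_discrete]
  simp only [ENat.toENNReal_coe, expNeg_mul_natCast]
  rw [lintegral_pow_poissonMeasure _ (expNeg_le_one y), hmean, mul_assoc,
    mul_comm (volume A)]

lemma lintegral_expNeg_sum_count (hX : IsPoissonProcess P lam X) (hlam : 0 ≤ lam)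
    {ι : Type*} [Fintype ι] {A : ι → Set ℝ} (hA : ∀ k, MeasurableSet (A k))
    (hAfin : ∀ k, volume (A k) < ∞) (hdisj : Pairwise (Disjoint on A)) (y : ι → ℝ≥0∞) :
    ∫⁻ ω, expNeg (∑ k, y k * (count X (A k) ω : ℝ≥0∞)) ∂P
      = expNeg (ENNReal.ofReal lam * ∑ k, (1 - expNeg (y k)) * volume (A k)) := by
  let e := (Fintype.equivFin ι).symm
  have hind : iIndepFun (fun k => (fun n : ℕ∞ => expNeg (y (e k) * (n : ℝ≥0∞))) ∘
      count X (A (e k))) P :=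
    (hX.indep _ (A ∘ e) (fun k => hA _) fun k l hkl => hdisj (e.injective.ne hkl)).comp _
      fun _ => Measurable.of_discrete
  have hprod := lintegral_prod_eq_prod_lintegral_of_indepFun Finset.univ _ hind
    fun k => (Measurable.of_discrete).comp (hX.measurable_count (hA (e k)))
  simp only [Function.comp_apply, hX.lintegral_expNeg_mul_count hlam (hA _) (hAfin _),
    ← expNeg_sum, ← Finset.mul_sum] at hprod
  simpa only [← e.sum_comp] using hprod

lemma lintegral_expNeg_simpleFunc (hX : IsPoissonProcess P lam X) (hlam : 0 ≤ lam)
    (s : SimpleFunc ℝ ℝ≥0∞) (hs : s.FinMeasSupp volume) :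
    ∫⁻ ω, expNeg (∑' i, s (X i ω)) ∂P
      = expNeg (ENNReal.ofReal lam * ∫⁻ x, (1 - expNeg (s x))) := by
  let R : Finset ℝ≥0∞ := s.range.filter fun y => y ≠ 0
  have hsum (F : ℝ≥0∞ → ℝ≥0∞) (hF : F 0 = 0) :
      ∑ y ∈ s.range, F y = ∑ y : R, F y := by
    rw [Finset.sum_coe_sort R F]
    exact (Finset.sum_filter_of_ne (p := fun y => y ≠ 0) fun y _ hy h0 =>
      hy (by rw [h0, hF])).symm
  have hne (y : R) : (y : ℝ≥0∞) ≠ 0 := (Finset.mem_filter.1 y.2).2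
  have hint : ∫⁻ x, (1 - expNeg (s x)) = ∑ y ∈ s.range, (1 - expNeg y) * volume (s ⁻¹' {y}) := by
    rw [← SimpleFunc.map_lintegral fun y => 1 - expNeg y, ← SimpleFunc.lintegral_eq_lintegral]
    rfl
  have htsum (ω : Ω) : ∑' i, s (X i ω) = ∑ y : R, y * (count X (s ⁻¹' {(y : ℝ≥0∞)}) ω : ℝ≥0∞) := by
    rw [tsum_simpleFunc_eq_sum_encard]
    exact hsum (fun y => y * (count X (s ⁻¹' {y}) ω : ℝ≥0∞)) (zero_mul _)
  simp_rw [htsum]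
  rw [hint, hsum (fun y => (1 - expNeg y) * volume (s ⁻¹' {y})) (by simp)]
  refine hX.lintegral_expNeg_sum_count hlam (fun y => s.measurableSet_fiber _)
    (fun y => SimpleFunc.finMeasSupp_iff.1 hs _ (hne y)) (fun y z hyz => ?_)
    fun y : R => (y : ℝ≥0∞)
  exact Disjoint.preimage _ (disjoint_singleton.2 fun h => hyz (Subtype.ext h))

theorem lintegral_expNeg [IsFiniteMeasure P] (hX : IsPoissonProcess P lam X) (hlam : 0 ≤ lam)
    {ψ : ℝ → ℝ≥0∞} (hψ : Measurable ψ) :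
    ∫⁻ ω, expNeg (∑' i, ψ (X i ω)) ∂P
      = expNeg (ENNReal.ofReal lam * ∫⁻ x, (1 - expNeg (ψ x))) := by
  obtain ⟨s, hmono, hlim, hfin⟩ := exists_simpleFunc_tendsto volume hψ
  have hleft : Tendsto (fun n => ∫⁻ ω, expNeg (∑' i, s n (X i ω)) ∂P) atTop
      (𝓝 (∫⁻ ω, expNeg (∑' i, ψ (X i ω)) ∂P)) :=
    tendsto_lintegral_expNeg
      (fun n => Measurable.tsum fun i => (s n).measurable.comp (hX.measurable i))
      (fun ω => tendsto_tsum_of_monotone (fun i => hmono _) (fun i => hlim _))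
  have hright : Tendsto (fun n => expNeg (ENNReal.ofReal lam * ∫⁻ x, (1 - expNeg (s n x)))) atTop
      (𝓝 (expNeg (ENNReal.ofReal lam * ∫⁻ x, (1 - expNeg (ψ x))))) :=
    (continuous_expNeg.tendsto _).comp (ENNReal.Tendsto.const_mul
      (tendsto_lintegral_one_sub_expNeg (fun n => (s n).measurable) hmono hlim)
      (Or.inr ENNReal.ofReal_ne_top))
  exact tendsto_nhds_unique hleft
    (hright.congr fun n => (hX.lintegral_expNeg_simpleFunc hlam (s n) (hfin n)).symm)

end IsPoissonProcess

/-! ### Independent marks -/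

section Independence

variable {Ω α β γ : Type*} [MeasurableSpace Ω] [MeasurableSpace α] [MeasurableSpace β]
  [MeasurableSpace γ] {P : Measure Ω}

lemma lintegral_expNeg_sum_of_iIndepFun {ι : Type*} {V : ι → Ω → β} {ρ : Measure β}
    (hV : ∀ i, Measurable (V i)) (hlaw : ∀ i, P.map (V i) = ρ) (hind : iIndepFun V P)
    {f : ι → β → ℝ≥0∞} (hf : ∀ i, Measurable (f i)) (s : Finset ι) :
    ∫⁻ ω, expNeg (∑ i ∈ s, f i (V i ω)) ∂P = ∏ i ∈ s, ∫⁻ v, expNeg (f i v) ∂ρ := by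
  have hexp (i : ι) : Measurable fun v => expNeg (f i v) := measurable_expNeg.comp (hf i)
  have hprod := lintegral_prod_eq_prod_lintegral_of_indepFun s _
    (hind.comp (fun i v => expNeg (f i v)) hexp) fun i => (hexp i).comp (hV i)
  simp only [Function.comp_apply] at hprod
  simp_rw [expNeg_sum, hprod]
  exact Finset.prod_congr rfl fun i _ => by rw [← lintegral_map (hexp i) (hV i), hlaw i]

variable [IsProbabilityMeasure P]

lemma indepFun_prodMk_left {A : Ω → α} {B : Ω → β} {C : Ω → γ} (hA : Measurable A)
    (hB : Measurable B) (hC : Measurable C) (hABC : IndepFun A (fun ω => (B ω, C ω)) P)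
    (hBC : IndepFun B C P) : IndepFun (fun ω => (A ω, B ω)) C P := by
  have := Measure.isProbabilityMeasure_map (μ := P) hA.aemeasurable
  have := Measure.isProbabilityMeasure_map (μ := P) hB.aemeasurable
  have := Measure.isProbabilityMeasure_map (μ := P) hC.aemeasurable
  have hAB : IndepFun A B P := hABC.comp measurable_id measurable_fst
  rw [indepFun_iff_map_prod_eq_prod_map_map hA.aemeasurable (hB.prodMk hC).aemeasurable] at hABC
  rw [indepFun_iff_map_prod_eq_prod_map_map hB.aemeasurable hC.aemeasurable] at hBC
  rw [indepFun_iff_map_prod_eq_prod_map_map hA.aemeasurable hB.aemeasurable] at hAB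
  rw [indepFun_iff_map_prod_eq_prod_map_map (hA.prodMk hB).aemeasurable hC.aemeasurable, hAB]
  apply (MeasurableEquiv.prodAssoc (α := α) (β := β) (γ := γ)).map_measurableEquiv_injective
  rw [Measure.prodAssoc_prod, ← hBC, ← hABC,
    Measure.map_map MeasurableEquiv.prodAssoc.measurable ((hA.prodMk hB).prodMk hC)]
  rfl

lemma lintegral_comp_prodMk_of_indepFun {A : Ω → α} {B : Ω → β} (hA : Measurable A)
    (hB : Measurable B) (hAB : IndepFun A B P) {f : α × β → ℝ≥0∞} (hf : Measurable f) :
    ∫⁻ ω, f (A ω, B ω) ∂P = ∫⁻ ω, ∫⁻ b, f (A ω, b) ∂P.map B ∂P := by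
  have := Measure.isProbabilityMeasure_map (μ := P) hB.aemeasurable
  rw [← lintegral_map hf (hA.prodMk hB),
    (indepFun_iff_map_prod_eq_prod_map_map hA.aemeasurable hB.aemeasurable).1 hAB,
    lintegral_prod _ hf.aemeasurable, lintegral_map hf.lintegral_prod_right' hA]

variable {U : ℕ → Ω → α} {V : ℕ → Ω → β} {ρ : Measure β} [IsProbabilityMeasure ρ]

lemma measurable_negLog_lintegral_expNeg {Ψ : α × β → ℝ≥0∞} (hΨ : Measurable Ψ) :
    Measurable fun u => negLog (∫⁻ v, expNeg (Ψ (u, v)) ∂ρ) :=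
  measurable_negLog.comp (measurable_expNeg.comp hΨ).lintegral_prod_right'

lemma lintegral_expNeg_sum_marks (hU : ∀ i, Measurable (U i)) (hV : ∀ i, Measurable (V i))
    (hlaw : ∀ i, P.map (V i) = ρ) (hind : iIndepFun V P)
    (hUV : IndepFun (fun ω i => U i ω) (fun ω i => V i ω) P) {Ψ : α × β → ℝ≥0∞}
    (hΨ : Measurable Ψ) (s : Finset ℕ) :
    ∫⁻ ω, expNeg (∑ i ∈ s, Ψ (U i ω, V i ω)) ∂P
      = ∫⁻ ω, expNeg (∑ i ∈ s, negLog (∫⁻ v, expNeg (Ψ (U i ω, v)) ∂ρ)) ∂P := by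
  have hm : Measurable fun p : (ℕ → α) × (ℕ → β) => expNeg (∑ i ∈ s, Ψ (p.1 i, p.2 i)) :=
    measurable_expNeg.comp (Finset.measurable_sum _ fun i _ => hΨ.comp (by fun_prop))
  rw [lintegral_comp_prodMk_of_indepFun (measurable_pi_lambda _ hU) (measurable_pi_lambda _ hV)
    hUV hm]
  refine lintegral_congr fun ω => ?_
  have hmω : Measurable fun v : ℕ → β => expNeg (∑ i ∈ s, Ψ (U i ω, v i)) :=
    hm.comp (measurable_prodMk_left (x := fun i => U i ω))
  rw [lintegral_map hmω (measurable_pi_lambda _ hV),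
    lintegral_expNeg_sum_of_iIndepFun hV hlaw hind
      (f := fun i v => Ψ (U i ω, v)) (fun i => hΨ.comp measurable_prodMk_left), expNeg_sum]
  exact Finset.prod_congr rfl fun i _ => (expNeg_negLog (lintegral_expNeg_le_one _)).symm

theorem lintegral_expNeg_marks (hU : ∀ i, Measurable (U i)) (hV : ∀ i, Measurable (V i))
    (hlaw : ∀ i, P.map (V i) = ρ) (hind : iIndepFun V P)
    (hUV : IndepFun (fun ω i => U i ω) (fun ω i => V i ω) P) {Ψ : α × β → ℝ≥0∞}
    (hΨ : Measurable Ψ) :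
    ∫⁻ ω, expNeg (∑' i, Ψ (U i ω, V i ω)) ∂P
      = ∫⁻ ω, expNeg (∑' i, negLog (∫⁻ v, expNeg (Ψ (U i ω, v)) ∂ρ)) ∂P := by
  have hleft := tendsto_lintegral_expNeg (μ := P)
    (f := fun n ω => ∑ i ∈ Finset.range n, Ψ (U i ω, V i ω))
    (fun n => Finset.measurable_sum _ fun i _ => hΨ.comp ((hU i).prodMk (hV i)))
    (fun ω => ENNReal.tendsto_nat_tsum _)
  have hright := tendsto_lintegral_expNeg (μ := P)
    (f := fun n ω => ∑ i ∈ Finset.range n, negLog (∫⁻ v, expNeg (Ψ (U i ω, v)) ∂ρ))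
    (fun n => Finset.measurable_sum _ fun i _ =>
      (measurable_negLog_lintegral_expNeg hΨ).comp (hU i))
    (fun ω => ENNReal.tendsto_nat_tsum _)
  exact tendsto_nhds_unique hleft (hright.congr fun n =>
    (lintegral_expNeg_sum_marks hU hV hlaw hind hUV hΨ (Finset.range n)).symm)

theorem IsPoissonProcess.lintegral_expNeg_marks {lam : ℝ} {X : ℕ → Ω → ℝ}
    (hX : IsPoissonProcess P lam X) (hlam : 0 ≤ lam) (hV : ∀ i, Measurable (V i))
    (hlaw : ∀ i, P.map (V i) = ρ) (hind : iIndepFun V P)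
    (hXV : IndepFun (fun ω i => X i ω) (fun ω i => V i ω) P) {Ψ : ℝ × β → ℝ≥0∞}
    (hΨ : Measurable Ψ) :
    ∫⁻ ω, expNeg (∑' i, Ψ (X i ω, V i ω)) ∂P
      = expNeg (ENNReal.ofReal lam * ∫⁻ x, (1 - ∫⁻ v, expNeg (Ψ (x, v)) ∂ρ)) := by
  rw [CV2X.lintegral_expNeg_marks hX.measurable hV hlaw hind hXV hΨ,
    hX.lintegral_expNeg hlam (measurable_negLog_lintegral_expNeg hΨ)]
  simp_rw [expNeg_negLog (lintegral_expNeg_le_one _)]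

end Independence

/-! ### The displaced process -/

/-- The law of the log-normal shadowing gain `χ`, where `10 log₁₀ χ ∼ N(w, v)`. -/
noncomputable def shadowing (w : ℝ) (v : ℝ≥0) : Measure ℝ :=
  (gaussianReal w v).map fun n => Real.exp (Real.log 10 / 10 * n)

instance (w : ℝ) (v : ℝ≥0) : IsProbabilityMeasure (shadowing w v) :=
  Measure.isProbabilityMeasure_map (by fun_prop)

lemma ae_shadowing_pos (w : ℝ) (v : ℝ≥0) : ∀ᵐ c ∂shadowing w v, 0 < c := by
  rw [shadowing, ae_map_iff (by fun_prop) measurableSet_Ioi]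
  exact ae_of_all _ fun x => Real.exp_pos _

lemma lintegral_shadowing_rpow (w a : ℝ) (v : ℝ≥0) :
    ∫⁻ c, ENNReal.ofReal (c ^ a) ∂shadowing w v
      = ENNReal.ofReal (Real.exp (w * (Real.log 10 / 10 * a)
        + v * (Real.log 10 / 10 * a) ^ 2 / 2)) := by
  have hpow (x : ℝ) :
      Real.exp (Real.log 10 / 10 * x) ^ a = Real.exp (Real.log 10 / 10 * a * x) := by
    rw [← Real.exp_mul]
    ring_nf
  rw [shadowing, lintegral_map (by fun_prop) (by fun_prop)]
  simp_rw [hpow]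
  rw [← ofReal_integral_eq_lintegral_ofReal (integrable_exp_mul_gaussianReal _)
    (ae_of_all _ fun x => (Real.exp_pos _).le)]
  exact congrArg ENNReal.ofReal (congrFun mgf_id_gaussianReal (Real.log 10 / 10 * a))

lemma lintegral_comp_abs {f : ℝ → ℝ≥0∞} (hf : Measurable f) :
    ∫⁻ x, f |x| = 2 * ∫⁻ x in Ioi 0, f x := by
  have hpos : ∫⁻ x in Ioi 0, f |x| = ∫⁻ x in Ioi 0, f x :=
    setLIntegral_congr_fun measurableSet_Ioi fun x hx => by rw [abs_of_pos hx]
  have hneg : ∫⁻ x in Iic 0, f |x| = ∫⁻ x in Ioi 0, f x := by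
    rw [← (Measure.measurePreserving_neg (volume : Measure ℝ)).setLIntegral_comp_preimage
      (measurableSet_Ioi (a := (0 : ℝ))) hf, setLIntegral_congr Iio_ae_eq_Iic.symm, neg_preimage,
      neg_Ioi, neg_zero]
    exact setLIntegral_congr_fun measurableSet_Iio fun x hx => by rw [abs_of_neg hx]
  rw [← lintegral_add_compl _ (measurableSet_Ioi (a := (0 : ℝ))), compl_Ioi, hpos, hneg, two_mul]

lemma lintegral_comp_abs_mul {f : ℝ → ℝ≥0∞} (hf : Measurable f) {a : ℝ} (ha : 0 < a) :
    ∫⁻ x, f |a * x| = ENNReal.ofReal a⁻¹ * (2 * ∫⁻ x in Ioi 0, f x) := by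
  rw [← lintegral_comp_abs hf, ← lintegral_map (f := fun x => f |x|) (hf.comp (by fun_prop))
    (measurable_const_mul a), Real.map_volume_mul_left ha.ne', lintegral_smul_measure,
    abs_of_pos (inv_pos.2 ha), smul_eq_mul]

lemma lintegral_lintegral_comp_abs_rpow_mul {σ : Measure ℝ} [SFinite σ] (hσ : ∀ᵐ c ∂σ, 0 < c)
    {f : ℝ → ℝ≥0∞} (hf : Measurable f) (a : ℝ) :
    ∫⁻ x, ∫⁻ c, f |c ^ (-a) * x| ∂σ
      = (∫⁻ c, ENNReal.ofReal (c ^ a) ∂σ) * (2 * ∫⁻ r in Ioi 0, f r) := by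
  have hm : Measurable fun p : ℝ × ℝ => f |p.2 ^ (-a) * p.1| := hf.comp (by fun_prop)
  rw [lintegral_lintegral_swap hm.aemeasurable,
    ← lintegral_mul_const _ (by fun_prop)]
  refine lintegral_congr_ae ?_
  filter_upwards [hσ] with c hc
  rw [lintegral_comp_abs_mul hf (Real.rpow_pos_of_pos hc _), Real.rpow_neg hc.le, inv_inv]

lemma ofReal_mul_lintegral_one_sub_lintegral_shadowing {lamd alpha w : ℝ} {v : ℝ≥0}
    {φ : ℝ → ℝ≥0∞} (hφ : Measurable φ) (hφ_le : ∀ r, φ r ≤ 1) :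
    ENNReal.ofReal lamd * ∫⁻ x, (1 - ∫⁻ c, φ |c ^ (-(1 / alpha)) * x| ∂shadowing w v)
      = ENNReal.ofReal (2 * lamD lamd alpha w v) * ∫⁻ r in Ioi 0, (1 - φ r) := by
  have hsub (x : ℝ) : 1 - ∫⁻ c, φ |c ^ (-(1 / alpha)) * x| ∂shadowing w v
      = ∫⁻ c, (1 - φ |c ^ (-(1 / alpha)) * x|) ∂shadowing w v := by
    have hle : ∫⁻ c, φ |c ^ (-(1 / alpha)) * x| ∂shadowing w v ≤ 1 :=
      (lintegral_mono fun c => hφ_le _).trans (by simp)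
    rw [lintegral_sub (g := fun c => φ |c ^ (-(1 / alpha)) * x|) (hφ.comp (by fun_prop))
      (ne_top_of_le_ne_top ENNReal.one_ne_top hle)
      (ae_of_all _ fun c => hφ_le _)]
    simp
  have hexponent : w * (Real.log 10 / 10 * (1 / alpha))
        + v * (Real.log 10 / 10 * (1 / alpha)) ^ 2 / 2
      = w * Real.log 10 / (10 * alpha) + 1 / 2 * v * (Real.log 10 / (10 * alpha)) ^ 2 := by
    rw [div_mul_div_comm, mul_one]
    ring
  simp_rw [hsub]
  rw [lintegral_lintegral_comp_abs_rpow_mul (f := fun r => 1 - φ r) (ae_shadowing_pos w v)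
    (measurable_const.sub hφ), lintegral_shadowing_rpow, hexponent, lamD,
    ENNReal.ofReal_mul zero_le_two, ENNReal.ofReal_mul (Real.exp_pos _).le, ENNReal.ofReal_ofNat]
  ring

/-- The distances `|Y i|`, marked by `G i`, form a Poisson process on `(0, ∞) × E` with intensity
`L dr ⊗ ρ`, expressed through its Laplace functional. -/
structure IsRadialPoisson {Ω E : Type*} [MeasurableSpace Ω] [MeasurableSpace E] (P : Measure Ω)
    (L : ℝ) (ρ : Measure E) (Y : ℕ → Ω → ℝ) (G : ℕ → Ω → E) : Prop where
  measurable_Y : ∀ i, Measurable (Y i)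
  measurable_G : ∀ i, Measurable (G i)
  laplace : ∀ h : ℝ × E → ℝ≥0∞, Measurable h →
    ∫⁻ ω, expNeg (∑' i, h (|Y i ω|, G i ω)) ∂P
      = expNeg (ENNReal.ofReal L * ∫⁻ r in Ioi 0, (1 - ∫⁻ x, expNeg (h (r, x)) ∂ρ))

lemma measurable_displaced {Ω : Type*} [MeasurableSpace Ω] {X chi : ℕ → Ω → ℝ}
    (hX : ∀ i, Measurable (X i)) (hchi : ∀ i, Measurable (chi i)) (alpha : ℝ) (i : ℕ) :
    Measurable (displaced alpha X chi i) :=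
  ((hchi i).pow_const _).mul (hX i)

lemma lamD_pos {lamd alpha w : ℝ} {v : ℝ≥0} (h : 0 < lamd) : 0 < lamD lamd alpha w v :=
  mul_pos (Real.exp_pos _) h

namespace IsDownlink

variable {Ω : Type*} [MeasurableSpace Ω] {P : Measure Ω} {lamd mu w : ℝ} {v : ℝ≥0}
  {X chi G : ℕ → Ω → ℝ} {g : Ω → ℝ}

lemma map_chi (hnet : IsDownlink P lamd mu w v X chi G g) (i : ℕ) :
    P.map (chi i) = shadowing w v := by
  rw [shadowing, ← (hnet.chi_law i).map_eq,
    AEMeasurable.map_map_of_aemeasurable (by fun_prop) (hnet.chi_law i).aemeasurable]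
  refine Measure.map_congr ?_
  filter_upwards [hnet.chi_pos i] with ω hω
  have hlog : Real.log 10 / 10 * (10 * Real.logb 10 (chi i ω)) = Real.log (chi i ω) := by
    have h10 : Real.log 10 ≠ 0 := (Real.log_pos (by norm_num)).ne'
    rw [Real.logb]
    field_simp
  rw [Function.comp_apply, hlog, Real.exp_log hω]

variable [IsProbabilityMeasure P]

lemma indepFun_prodMk_X_chi (hnet : IsDownlink P lamd mu w v X chi G g) :
    IndepFun (fun ω => ((fun i => X i ω), fun i => chi i ω)) (fun ω => ((fun i => G i ω), g ω)) P :=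
  indepFun_prodMk_left (measurable_pi_lambda _ hnet.poisson.measurable)
    (measurable_pi_lambda _ hnet.chi_measurable)
    ((measurable_pi_lambda _ hnet.G_measurable).prodMk hnet.g_measurable) hnet.indep_X
    hnet.indep_chi

theorem isRadialPoisson (hnet : IsDownlink P lamd mu w v X chi G g) (hlamd : 0 ≤ lamd)
    (hmu : 0 < mu) (alpha : ℝ) :
    IsRadialPoisson P (2 * lamD lamd alpha w v) (expMeasure mu) (displaced alpha X chi) G := by
  have := isProbabilityMeasure_expMeasure hmu
  refine ⟨measurable_displaced hnet.poisson.measurable hnet.chi_measurable alpha,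
    hnet.G_measurable, fun h hh => ?_⟩
  have hXchi_G : IndepFun (fun ω i => (X i ω, chi i ω)) (fun ω i => G i ω) P :=
    hnet.indepFun_prodMk_X_chi.comp
      (φ := fun p : (ℕ → ℝ) × (ℕ → ℝ) => fun i => (p.1 i, p.2 i)) (by fun_prop) measurable_fst
  have hX_chi : IndepFun (fun ω i => X i ω) (fun ω i => chi i ω) P :=
    hnet.indep_X.comp measurable_id measurable_fst
  let φ : ℝ → ℝ≥0∞ := fun r => ∫⁻ x, expNeg (h (r, x)) ∂expMeasure mu
  have hφ : Measurable φ := (measurable_expNeg.comp hh).lintegral_prod_right'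
  have hφ_le (r : ℝ) : φ r ≤ 1 := lintegral_expNeg_le_one _
  calc ∫⁻ ω, expNeg (∑' i, h (|displaced alpha X chi i ω|, G i ω)) ∂P
    _ = ∫⁻ ω, expNeg (∑' i, negLog (φ |displaced alpha X chi i ω|)) ∂P :=
      lintegral_expNeg_marks (U := fun i ω => (X i ω, chi i ω))
        (Ψ := fun q : (ℝ × ℝ) × ℝ => h (|q.1.2 ^ (-(1 / alpha)) * q.1.1|, q.2))
        (fun i => (hnet.poisson.measurable i).prodMk (hnet.chi_measurable i)) hnet.G_measurable
        (fun i => (hnet.G_law i).map_eq) hnet.G_indep hXchi_G (hh.comp (by fun_prop))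
    _ = expNeg (ENNReal.ofReal lamd
          * ∫⁻ x, (1 - ∫⁻ c, expNeg (negLog (φ |c ^ (-(1 / alpha)) * x|)) ∂shadowing w v)) :=
      hnet.poisson.lintegral_expNeg_marks hlamd hnet.chi_measurable hnet.map_chi hnet.chi_indep
        hX_chi (Ψ := fun p : ℝ × ℝ => negLog (φ |p.2 ^ (-(1 / alpha)) * p.1|))
        (measurable_negLog.comp (hφ.comp (by fun_prop)))
    _ = expNeg (ENNReal.ofReal (2 * lamD lamd alpha w v) * ∫⁻ r in Ioi 0, (1 - φ r)) := by
      simp_rw [expNeg_negLog (hφ_le _)]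
      rw [ofReal_mul_lintegral_one_sub_lintegral_shadowing hφ hφ_le]

end IsDownlink

/-! ### Ordered distances -/

/-- A configuration of distinct positive distances, finitely many below each level: the almost sure
shape of the distances of a Poisson process. -/
structure IsSimpleConfig (d : ℕ → ℝ) : Prop where
  pos : ∀ i, 0 < d i
  finite : ∀ r, {i | d i ≤ r}.Finite
  inj : Injective d

/-- The `k`-th smallest of the numbers `d i`, counted from `k = 1`; the value `0` at `k = 0` makes
"the points beyond the `k`-th" meaningful for every `k`. -/
noncomputable def orderStat (d : ℕ → ℝ) : ℕ → ℝ
  | 0 => 0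
  | k + 1 => sInf {r : ℝ | 0 ≤ r ∧ ((k + 1 : ℕ) : ℕ∞) ≤ {i : ℕ | d i ≤ r}.encard}

namespace IsSimpleConfig

variable {d : ℕ → ℝ}

lemma exists_gap (hd : IsSimpleConfig d) (r : ℝ) : ∃ r' > r, {i | d i ≤ r'} = {i | d i ≤ r} := by
  have hfin : {i | r < d i ∧ d i ≤ r + 1}.Finite := (hd.finite (r + 1)).subset fun i hi => hi.2
  have hbelow : ∀ᶠ c in 𝓝[>] r, ∀ i ∈ {i | r < d i ∧ d i ≤ r + 1}, c < d i :=
    (eventually_all_finite hfin).2 fun i hi => nhdsWithin_le_nhds (Iio_mem_nhds hi.1)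
  have hle : ∀ᶠ c in 𝓝[>] r, c ≤ r + 1 := nhdsWithin_le_nhds (Iic_mem_nhds (by linarith))
  obtain ⟨c, hc, hc1, hcr⟩ := (hbelow.and (hle.and self_mem_nhdsWithin)).exists
  refine ⟨c, hcr, Set.ext fun i => ⟨fun hi => ?_, fun hi => le_trans hi (le_of_lt hcr)⟩⟩
  by_contra hlt
  exact absurd (hc i ⟨not_le.1 hlt, le_trans hi hc1⟩) (not_lt.2 hi)

lemma isLeast_orderStat_succ (hd : IsSimpleConfig d) (k : ℕ) :
    IsLeast {r : ℝ | 0 ≤ r ∧ ((k + 1 : ℕ) : ℕ∞) ≤ {i : ℕ | d i ≤ r}.encard}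
      (orderStat d (k + 1)) := by
  set S := {r : ℝ | 0 ≤ r ∧ ((k + 1 : ℕ) : ℕ∞) ≤ {i : ℕ | d i ≤ r}.encard}
  have hne : S.Nonempty := by
    refine ⟨∑ i ∈ Finset.range (k + 1), d i, Finset.sum_nonneg fun i _ => (hd.pos i).le, ?_⟩
    have hsub : ((Finset.range (k + 1) : Finset ℕ) : Set ℕ)
        ⊆ {i | d i ≤ ∑ i ∈ Finset.range (k + 1), d i} := fun i hi =>
      Finset.single_le_sum (f := d) (fun j _ => (hd.pos j).le) (Finset.mem_coe.1 hi)
    simpa only [encard_coe_eq_coe_finsetCard, Finset.card_range] using encard_le_encard hsub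
  refine ⟨⟨le_csInf hne fun r hr => hr.1, ?_⟩, fun r hr => csInf_le ⟨0, fun r hr => hr.1⟩ hr⟩
  by_contra hlt
  obtain ⟨r', hr', heq⟩ := hd.exists_gap (sInf S)
  obtain ⟨s, hs, hsr⟩ := exists_lt_of_csInf_lt hne hr'
  refine hlt (hs.2.trans ?_)
  rw [orderStat, ← heq]
  exact encard_le_encard fun i hi => le_trans hi hsr.le

lemma orderStat_succ_le_iff (hd : IsSimpleConfig d) (k : ℕ) (r : ℝ) :
    orderStat d (k + 1) ≤ r ↔ ((k + 1 : ℕ) : ℕ∞) ≤ {i | d i ≤ r}.encard := by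
  refine ⟨fun h => (hd.isLeast_orderStat_succ k).1.2.trans
    (encard_le_encard fun i hi => le_trans hi h), fun h => (hd.isLeast_orderStat_succ k).2 ⟨?_, h⟩⟩
  obtain ⟨i, hi⟩ : {i | d i ≤ r}.Nonempty :=
    encard_pos.1 (lt_of_lt_of_le (by exact_mod_cast k.succ_pos) h)
  exact (hd.pos i).le.trans hi

lemma exists_lt_of_le_encard (hd : IsSimpleConfig d) {n : ℕ} (hn : 0 < n) {y : ℝ}
    (h : (n : ℕ∞) ≤ {i | d i < y}.encard) : ∃ r < y, (n : ℕ∞) ≤ {i | d i ≤ r}.encard := by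
  have hfin : {i | d i < y}.Finite := (hd.finite y).subset fun i (hi : d i < y) => hi.le
  have hne : {i | d i < y}.Nonempty := encard_pos.1 (lt_of_lt_of_le (by exact_mod_cast hn) h)
  obtain ⟨j, hj, hmax⟩ := hfin.exists_maximalFor d _ hne
  refine ⟨d j, hj, h.trans (encard_le_encard fun i hi => ?_)⟩
  by_contra hlt
  exact hlt (hmax hi (le_of_lt (not_le.1 hlt)))

lemma encard_le_orderStat (hd : IsSimpleConfig d) (k : ℕ) :
    {i | d i ≤ orderStat d k}.encard = k := by
  cases k with
  | zero => simpa [orderStat, eq_empty_iff_forall_notMem] using hd.pos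
  | succ k =>
    refine le_antisymm ?_ ((hd.orderStat_succ_le_iff k _).1 le_rfl)
    by_contra! hlt
    set r := orderStat d (k + 1)
    have hat : {i | d i = r}.encard ≤ 1 := encard_le_one_iff.2 fun a b ha hb =>
      hd.inj ((show d a = r from ha).trans (show d b = r from hb).symm)
    have hsplit : {i | d i ≤ r} = {i | d i < r} ∪ {i | d i = r} := by
      ext i
      exact le_iff_lt_or_eq (a := d i)
    have hle : {i | d i ≤ r}.encard ≤ {i | d i < r}.encard + 1 :=
      hsplit ▸ (encard_union_le _ _).trans (by gcongr)
    obtain ⟨s, hs, hs'⟩ := hd.exists_lt_of_le_encard k.succ_pos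
      ((ENat.lt_add_one_iff' (ENat.natCast_ne_top _)).1 (hlt.trans_le hle))
    exact absurd ((hd.orderStat_succ_le_iff k s).2 hs') (not_le.2 hs)

lemma lt_orderStat_succ_iff (hd : IsSimpleConfig d) (k : ℕ) (c : ℝ) :
    c < orderStat d (k + 1) ↔ ∀ i, orderStat d k < d i → c < d i := by
  rw [← not_le, hd.orderStat_succ_le_iff, not_le]
  refine ⟨fun h i hi => ?_, fun h => ?_⟩
  · by_contra! hc
    have hsub : insert i {j | d j ≤ orderStat d k} ⊆ {j | d j ≤ c} :=
      insert_subset_iff.2 ⟨hc, fun j hj => le_trans hj (hi.le.trans hc)⟩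
    have hcard := encard_le_encard hsub
    rw [encard_insert_of_notMem (by simpa using hi), hd.encard_le_orderStat] at hcard
    exact absurd (hcard.trans_lt h) (by simp)
  · have hsub : {i | d i ≤ c} ⊆ {i | d i ≤ orderStat d k} := fun i hi => by
      by_contra hlt
      exact absurd (h i (not_le.1 hlt)) (not_lt.2 hi)
    refine (encard_le_encard hsub).trans_lt ?_
    rw [hd.encard_le_orderStat]
    exact_mod_cast k.lt_succ_self

lemma orderStat_lt_succ (hd : IsSimpleConfig d) (k : ℕ) : orderStat d k < orderStat d (k + 1) :=
  (hd.lt_orderStat_succ_iff k _).2 fun _ hi => hi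

lemma le_encard_lt_iff (hd : IsSimpleConfig d) {m : ℕ} (hm : 0 < m) (y : ℝ) :
    (m : ℕ∞) ≤ {i | d i < y}.encard ↔ orderStat d m < y := by
  obtain ⟨k, rfl⟩ := Nat.exists_eq_add_one.2 hm
  refine ⟨fun h => ?_, fun h => ?_⟩
  · obtain ⟨r, hr, hr'⟩ := hd.exists_lt_of_le_encard hm h
    exact ((hd.orderStat_succ_le_iff k r).2 hr').trans_lt hr
  · rw [← hd.encard_le_orderStat (k + 1)]
    exact encard_le_encard fun i hi => lt_of_le_of_lt hi h

end IsSimpleConfig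

lemma interference_eq_tsum {Ω : Type*} {Y G : ℕ → Ω → ℝ} (Pd alpha : ℝ) (m : ℕ) (ω : Ω) :
    interference Pd alpha Y G m ω = ∑' i, ((cooperating Y m ω)ᶜ : Set ℕ).indicator
      (fun i => ENNReal.ofReal (Pd * G i ω * |Y i ω| ^ (-alpha))) i :=
  tsum_subtype _ fun i => ENNReal.ofReal (Pd * G i ω * |Y i ω| ^ (-alpha))

section Measurability

variable {Ω : Type*} [MeasurableSpace Ω] {Y G : ℕ → Ω → ℝ}

lemma measurable_sInf_setOf_nonneg {p : ℝ → Ω → Prop} (hp : ∀ r, MeasurableSet {ω | p r ω})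
    (hmono : ∀ ω, Monotone fun r => p r ω) : Measurable fun ω => sInf {r | 0 ≤ r ∧ p r ω} := by
  have htoReal (ω : Ω) : sInf {r | 0 ≤ r ∧ p r ω}
      = (sInf (ENNReal.ofReal '' {r | 0 ≤ r ∧ p r ω})).toReal := by
    rw [ENNReal.toReal_sInf _ (forall_mem_image.2 fun _ _ => ENNReal.ofReal_ne_top), image_image]
    congr 1
    exact ((image_congr fun r hr => ENNReal.toReal_ofReal hr.1).trans (image_id' _)).symm
  simp_rw [htoReal]
  refine (measurable_of_Iio fun a => ?_).ennreal_toReal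
  have hrat : (fun ω => sInf (ENNReal.ofReal '' {r | 0 ≤ r ∧ p r ω})) ⁻¹' Iio a
      = ⋃ q : ℚ, {_ω | (0 : ℝ) ≤ q ∧ ENNReal.ofReal q < a} ∩ {ω | p q ω} := by
    ext ω
    simp only [mem_preimage, mem_Iio, sInf_lt_iff, mem_iUnion, exists_mem_image]
    refine ⟨fun ⟨r, ⟨_, hr⟩, hra⟩ => ?_, fun ⟨q, ⟨hq0, hqa⟩, hq⟩ => ⟨q, ⟨hq0, hq⟩, hqa⟩⟩
    obtain ⟨q, hq0, hrq, hqa⟩ := ENNReal.lt_iff_exists_rat_btwn.1 hra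
    have hle : r ≤ q := (ENNReal.ofReal_le_ofReal_iff (by exact_mod_cast hq0)).1 hrq.le
    exact ⟨q, ⟨by exact_mod_cast hq0, hqa⟩, hmono ω hle hr⟩
  rw [hrat]
  exact MeasurableSet.iUnion fun q => (MeasurableSet.const _).inter (hp q)

lemma measurable_nthDist (hY : ∀ i, Measurable (Y i)) (k : ℕ) : Measurable (nthDist Y k) :=
  measurable_sInf_setOf_nonneg
    (fun _ => measurable_encard_setOf (fun i => (hY i).abs measurableSet_Iic)
      (MeasurableSet.of_discrete (s := Ici _)))
    fun _ _ _ hrs h => h.trans (encard_le_encard fun _ hi => le_trans hi hrs)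

@[fun_prop]
lemma measurable_dists (hY : ∀ i, Measurable (Y i)) (m : ℕ) : Measurable (dists Y m) :=
  measurable_pi_lambda _ fun k => measurable_nthDist hY k

lemma measurable_interference (hY : ∀ i, Measurable (Y i)) (hG : ∀ i, Measurable (G i))
    (Pd alpha : ℝ) (m : ℕ) : Measurable (interference Pd alpha Y G m) := by
  have hcoop (i : ℕ) : MeasurableSet {ω | i ∈ (cooperating Y m ω)ᶜ} :=
    (measurable_encard_setOf (fun k => measurableSet_lt (hY k).abs (hY i).abs)
      (MeasurableSet.of_discrete (s := Iio _))).compl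
  have hterm (i : ℕ) : Measurable fun ω => ENNReal.ofReal (Pd * G i ω * |Y i ω| ^ (-alpha)) :=
    (((hG i).const_mul Pd).mul ((hY i).abs.pow_const (-alpha))).ennreal_ofReal
  rw [funext (interference_eq_tsum Pd alpha m)]
  exact Measurable.tsum fun i => (hterm i).indicator (hcoop i)

end Measurability

/-! ### Almost sure properties of the distances -/

lemma ae_eq_zero_of_lintegral_expNeg_eq_one {Ω : Type*} [MeasurableSpace Ω] {P : Measure Ω}
    [IsProbabilityMeasure P] {f : Ω → ℝ≥0∞} (h : ∫⁻ ω, expNeg (f ω) ∂P = 1) :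
    ∀ᵐ ω ∂P, f ω = 0 := by
  have hone : (fun ω => expNeg (f ω)) =ᵐ[P] fun _ => 1 :=
    ae_eq_of_ae_le_of_lintegral_le (ae_of_all _ fun ω => expNeg_le_one _) (by simp [h])
      aemeasurable_const (by simp [h])
  filter_upwards [hone] with ω hω
  exact expNeg_eq_one_iff.1 hω

lemma ae_lt_top_of_tendsto_lintegral_expNeg {Ω : Type*} [MeasurableSpace Ω] {P : Measure Ω}
    [IsProbabilityMeasure P] {f : Ω → ℝ≥0∞} (hf : Measurable f) {y : ℕ → ℝ≥0∞}
    (hy : ∀ n, y n ≠ 0) (h : Tendsto (fun n => ∫⁻ ω, expNeg (y n * f ω) ∂P) atTop (𝓝 1)) :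
    ∀ᵐ ω ∂P, f ω < ∞ := by
  have hfin : MeasurableSet {ω | f ω < ∞} := measurableSet_lt hf measurable_const
  have hle (n : ℕ) : ∫⁻ ω, expNeg (y n * f ω) ∂P ≤ P {ω | f ω < ∞} := by
    rw [← lintegral_indicator_one hfin]
    refine lintegral_mono fun ω => ?_
    by_cases hω : f ω < ∞
    · simpa [hω] using expNeg_le_one _
    · simp [not_lt_top_iff.1 hω, ENNReal.mul_top (hy n)]
  exact (prob_compl_eq_zero_iff hfin).2 (le_antisymm prob_le_one (le_of_tendsto' h hle))

-- Read as `1_{n ≥ 2} + 4 · 2⁻ⁿ ≤ 2 + 2 · 0ⁿ`: it bounds the probability that a random count is at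
-- least `2` by values of its Laplace transform.
lemma ite_two_le_add_le (n : ℕ∞) :
    (if 2 ≤ n then 1 else 0) + 4 * expNeg (negLog 2⁻¹ * n) ≤ 2 + 2 * expNeg (∞ * n) := by
  have hhalf : expNeg (negLog 2⁻¹) = 2⁻¹ := expNeg_negLog (by simp)
  have htwo : (2 : ℝ≥0∞) * 2⁻¹ = 1 := ENNReal.mul_inv_cancel two_ne_zero ENNReal.ofNat_ne_top
  have hfour : (4 : ℝ≥0∞) = 2 * 2 := by norm_num
  induction n using ENat.recTopCoe with
  | top =>
    have hne : negLog 2⁻¹ ≠ 0 := fun h => by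
      rw [h, expNeg_zero] at hhalf
      exact absurd hhalf.symm (by simp)
    simp [ENNReal.mul_top hne]
  | coe n =>
    rw [ENat.toENNReal_coe, expNeg_mul_natCast, expNeg_mul_natCast, hhalf, expNeg_top, hfour]
    rcases n with _ | _ | n
    · norm_num
    · simp [mul_assoc, htwo]
    · have hpow : 2 * 2 * (2⁻¹ : ℝ≥0∞) ^ (n + 2) = 2⁻¹ ^ n := by
        rw [pow_add, sq, show 2 * 2 * ((2⁻¹ : ℝ≥0∞) ^ n * (2⁻¹ * 2⁻¹))
          = 2 * 2⁻¹ * (2 * 2⁻¹) * 2⁻¹ ^ n by ring, htwo, one_mul, one_mul]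
      have htwo_le : (2 : ℕ∞) ≤ (n + 2 : ℕ) := by exact_mod_cast Nat.le_add_left 2 n
      rw [hpow, if_pos htwo_le, zero_pow (by lia), mul_zero, add_zero, ← one_add_one_eq_two]
      gcongr
      exact pow_le_one' (by simp) n

lemma le_sq_div_two_of_add_le {p θ : ℝ≥0∞} (h : p + 4 * expNeg (θ / 2) ≤ 2 + 2 * expNeg θ) :
    p ≤ θ ^ 2 / 2 := by
  induction θ with
  | top => simp [ENNReal.top_div]
  | coe θ =>
    obtain ⟨z, hz⟩ : ∃ z : ℝ≥0, (z : ℝ) = Real.exp (-(θ / 2)) := ⟨⟨_, (Real.exp_pos _).le⟩, rfl⟩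
    have hhalf : expNeg (θ / 2) = z := by
      rw [← ENNReal.ofReal_coe_nnreal (p := z), hz, ← expNeg_ofReal (by positivity),
        ENNReal.ofReal_div_of_pos two_pos, ENNReal.ofReal_coe_nnreal, ENNReal.ofReal_ofNat]
    have hsq : expNeg θ = z ^ 2 := by
      rw [← hhalf, ← expNeg_mul_natCast, Nat.cast_ofNat,
        ENNReal.div_mul_cancel two_ne_zero ENNReal.ofNat_ne_top]
    rw [hhalf, hsq] at h
    lift p to ℝ≥0 using ne_top_of_le_ne_top (by finiteness) (le_self_add.trans h)
    have hreal : (p : ℝ) + 4 * z ≤ 2 + 2 * z ^ 2 := by exact_mod_cast h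
    have hz1 : (z : ℝ) ≤ 1 := hz ▸ Real.exp_le_one_iff.2 (neg_nonpos.2 (by positivity))
    have hzθ : 1 - (z : ℝ) ≤ θ / 2 := by linarith [Real.add_one_le_exp (-(θ / 2 : ℝ))]
    have hpθ : (p : ℝ) ≤ θ ^ 2 / 2 := by nlinarith
    have hpθ' : p ≤ θ ^ 2 / 2 := by exact_mod_cast hpθ
    simpa [ENNReal.coe_div] using ENNReal.coe_le_coe.2 hpθ'

lemma exists_mem_Ioc_div {k M : ℕ} (hk : 0 < k) {r : ℝ} (hr : r ∈ Ioc (0 : ℝ) M) :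
    ∃ j < M * k, r ∈ Ioc ((j : ℝ) / k) ((j + 1) / k) := by
  have hk' : (0 : ℝ) < k := by exact_mod_cast hk
  obtain ⟨j, hj⟩ := Nat.exists_eq_add_one.2 (Nat.ceil_pos.2 (mul_pos hr.1 hk'))
  obtain ⟨hlt, hle⟩ := (Nat.ceil_eq_iff j.succ_ne_zero).1 hj
  simp only [Nat.succ_sub_one, Nat.succ_eq_add_one, Nat.cast_add, Nat.cast_one] at hlt hle
  have hjM : (j : ℝ) < M * k := hlt.trans_le (by gcongr; exact hr.2)
  exact ⟨j, by exact_mod_cast hjM, (div_lt_iff₀ hk').2 hlt, (le_div_iff₀ hk').2 hle⟩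

namespace IsRadialPoisson

variable {Ω E : Type*} [MeasurableSpace Ω] [MeasurableSpace E] {P : Measure Ω} {L : ℝ}
  {ρ : Measure E} {Y : ℕ → Ω → ℝ} {G : ℕ → Ω → E}

lemma measurable_encard (hY : IsRadialPoisson P L ρ Y G) {A : Set ℝ} (hA : MeasurableSet A) :
    Measurable fun ω => {i | |Y i ω| ∈ A}.encard :=
  measurable_encard_setOf fun i => (hY.measurable_Y i).abs hA

variable [IsProbabilityMeasure ρ]

lemma lintegral_expNeg_mul_encard (hY : IsRadialPoisson P L ρ Y G) {A : Set ℝ}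
    (hA : MeasurableSet A) (y : ℝ≥0∞) :
    ∫⁻ ω, expNeg (y * {i | |Y i ω| ∈ A}.encard) ∂P
      = expNeg (ENNReal.ofReal L * ((1 - expNeg y) * volume (A ∩ Ioi 0))) := by
  have htsum (ω : Ω) : y * {i | |Y i ω| ∈ A}.encard = ∑' i, A.indicator (fun _ => y) |Y i ω| := by
    rw [mul_comm, ← ENNReal.tsum_set_const, tsum_subtype {i | |Y i ω| ∈ A} fun _ => y]
    rfl
  have hsub (r : ℝ) : 1 - expNeg (A.indicator (fun _ => y) r)
      = A.indicator (fun _ => 1 - expNeg y) r := by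
    by_cases h : r ∈ A <;> simp [h]
  simp_rw [htsum]
  rw [hY.laplace (fun p => A.indicator (fun _ => y) p.1)
    ((measurable_const.indicator hA).comp measurable_fst)]
  simp_rw [lintegral_const, measure_univ, mul_one, hsub]
  rw [lintegral_indicator_const hA, Measure.restrict_apply hA]

variable [IsProbabilityMeasure P]

lemma ae_pos (hY : IsRadialPoisson P L ρ Y G) : ∀ᵐ ω ∂P, ∀ i, 0 < |Y i ω| := by
  have hvoid : ∫⁻ ω, expNeg (1 * {i | |Y i ω| ∈ ({0} : Set ℝ)}.encard) ∂P = 1 := by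
    rw [hY.lintegral_expNeg_mul_encard (measurableSet_singleton 0),
      measure_mono_null inter_subset_left (measure_singleton 0)]
    simp
  filter_upwards [ae_eq_zero_of_lintegral_expNeg_eq_one hvoid] with ω hω i
  rw [one_mul, ENat.toENNReal_eq_zero, encard_eq_zero] at hω
  exact lt_of_le_of_ne (abs_nonneg _) fun h0 => (hω.subset h0.symm).elim

lemma ae_finite (hY : IsRadialPoisson P L ρ Y G) :
    ∀ᵐ ω ∂P, ∀ r : ℝ, {i | |Y i ω| ≤ r}.Finite := by
  have hnat (n : ℕ) : ∀ᵐ ω ∂P, (({i | |Y i ω| ∈ Iic (n : ℝ)}.encard : ℕ∞) : ℝ≥0∞) < ∞ := by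
    refine ae_lt_top_of_tendsto_lintegral_expNeg (y := fun k => (k : ℝ≥0∞)⁻¹)
      (Measurable.of_discrete.comp (hY.measurable_encard measurableSet_Iic)) (by simp) ?_
    simp_rw [hY.lintegral_expNeg_mul_encard measurableSet_Iic, Iic_inter_Ioi]
    have hsub : Tendsto (fun k : ℕ => 1 - expNeg (k : ℝ≥0∞)⁻¹) atTop (𝓝 (1 - expNeg 0)) :=
      ENNReal.Tendsto.sub tendsto_const_nhds
        ((continuous_expNeg.tendsto 0).comp ENNReal.tendsto_inv_nat_nhds_zero)
        (Or.inl ENNReal.one_ne_top)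
    have hlim := (continuous_expNeg.tendsto _).comp (ENNReal.Tendsto.const_mul
      (ENNReal.Tendsto.mul_const hsub (Or.inr (measure_Ioc_lt_top (μ := volume)
        (a := (0 : ℝ)) (b := n)).ne))
      (Or.inr (ENNReal.ofReal_ne_top (r := L))))
    simpa [comp_def] using hlim
  filter_upwards [ae_all_iff.2 hnat] with ω hω r
  obtain ⟨n, hn⟩ := exists_nat_ge r
  exact (encard_ne_top_iff.1 (ENat.toENNReal_lt_top.1 (hω n)).ne).subset
    fun i (hi : |Y i ω| ≤ r) => hi.trans hn

lemma measure_two_le_encard (hY : IsRadialPoisson P L ρ Y G) {A : Set ℝ} (hA : MeasurableSet A) :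
    P {ω | 2 ≤ {i | |Y i ω| ∈ A}.encard} ≤ (ENNReal.ofReal L * volume (A ∩ Ioi 0)) ^ 2 / 2 := by
  set θ := ENNReal.ofReal L * volume (A ∩ Ioi 0) with hθ
  have hset : MeasurableSet {ω | 2 ≤ {i | |Y i ω| ∈ A}.encard} :=
    hY.measurable_encard hA (MeasurableSet.of_discrete (s := Ici 2))
  have hhalf : ∫⁻ ω, expNeg (negLog 2⁻¹ * {i | |Y i ω| ∈ A}.encard) ∂P = expNeg (θ / 2) := by
    rw [hY.lintegral_expNeg_mul_encard hA, expNeg_negLog (by simp), ENNReal.one_sub_inv_two,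
      mul_left_comm, mul_comm, hθ, div_eq_mul_inv]
  have hvoid : ∫⁻ ω, expNeg (∞ * {i | |Y i ω| ∈ A}.encard) ∂P = expNeg θ := by
    rw [hY.lintegral_expNeg_mul_encard hA, expNeg_top, tsub_zero, one_mul]
  have hint := lintegral_mono (μ := P) fun ω => ite_two_le_add_le {i | |Y i ω| ∈ A}.encard
  have hind : ∫⁻ ω, (if 2 ≤ {i | |Y i ω| ∈ A}.encard then 1 else 0) ∂P
      = P {ω | 2 ≤ {i | |Y i ω| ∈ A}.encard} := by
    rw [← lintegral_indicator_one hset]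
    exact lintegral_congr fun ω => by simp only [indicator_apply, mem_ofPred_eq, Pi.one_apply]
  rw [lintegral_add_left (Measurable.ite hset measurable_const measurable_const), hind,
    lintegral_const_mul' _ _ (by finiteness), hhalf, lintegral_add_left measurable_const,
    lintegral_const, measure_univ, mul_one, lintegral_const_mul' _ _ (by finiteness), hvoid] at hint
  exact le_sq_div_two_of_add_le hint

lemma measure_exists_two_le_encard_le (hY : IsRadialPoisson P L ρ Y G) (M n : ℕ) :
    P {ω | ∃ r ∈ Ioc (0 : ℝ) M, 2 ≤ {i | |Y i ω| = r}.encard}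
      ≤ M * ENNReal.ofReal L ^ 2 / 2 * ((n + 1 : ℕ) : ℝ≥0∞)⁻¹ := by
  have hsub : {ω | ∃ r ∈ Ioc (0 : ℝ) M, 2 ≤ {i | |Y i ω| = r}.encard}
      ⊆ ⋃ j ∈ Finset.range (M * (n + 1)), {ω | 2 ≤
        {i | |Y i ω| ∈ Ioc ((j : ℝ) / (n + 1 : ℕ)) ((j + 1) / (n + 1 : ℕ))}.encard} := by
    rintro ω ⟨r, hr, htwo⟩
    obtain ⟨j, hj, hrj⟩ := exists_mem_Ioc_div n.succ_pos hr
    exact mem_biUnion (Finset.mem_range.2 hj)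
      (htwo.trans (encard_le_encard fun i hi => by rwa [← hi] at hrj))
  have hcell (j : ℕ) : volume (Ioc ((j : ℝ) / (n + 1 : ℕ)) ((j + 1) / (n + 1 : ℕ)) ∩ Ioi 0)
      ≤ ((n + 1 : ℕ) : ℝ≥0∞)⁻¹ := by
    refine (measure_mono inter_subset_left).trans_eq ?_
    rw [Real.volume_Ioc, add_div, add_sub_cancel_left, one_div,
      ENNReal.ofReal_inv_of_pos (by positivity), ENNReal.ofReal_natCast]
  calc P {ω | ∃ r ∈ Ioc (0 : ℝ) M, 2 ≤ {i | |Y i ω| = r}.encard}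
    _ ≤ ∑ _j ∈ Finset.range (M * (n + 1)),
        (ENNReal.ofReal L * ((n + 1 : ℕ) : ℝ≥0∞)⁻¹) ^ 2 / 2 := by
      refine (measure_mono hsub).trans ((measure_biUnion_finset_le _ _).trans ?_)
      refine Finset.sum_le_sum fun j _ => (hY.measure_two_le_encard measurableSet_Ioc).trans ?_
      gcongr
      exact hcell j
    _ = M * ENNReal.ofReal L ^ 2 / 2 * (((n + 1 : ℕ) : ℝ≥0∞) * ((n + 1 : ℕ) : ℝ≥0∞)⁻¹)
        * ((n + 1 : ℕ) : ℝ≥0∞)⁻¹ := by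
      rw [Finset.sum_const, Finset.card_range, nsmul_eq_mul, Nat.cast_mul, div_eq_mul_inv,
        div_eq_mul_inv]
      ring
    _ = M * ENNReal.ofReal L ^ 2 / 2 * ((n + 1 : ℕ) : ℝ≥0∞)⁻¹ := by
      rw [ENNReal.mul_inv_cancel (by simp) (by simp), mul_one]

lemma ae_injective (hY : IsRadialPoisson P L ρ Y G) : ∀ᵐ ω ∂P, Injective fun i => |Y i ω| := by
  have hbdd (M : ℕ) : P {ω | ∃ r ∈ Ioc (0 : ℝ) M, 2 ≤ {i | |Y i ω| = r}.encard} = 0 := by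
    have hlim := ENNReal.Tendsto.const_mul (a := M * ENNReal.ofReal L ^ 2 / 2)
      ((tendsto_add_atTop_iff_nat 1).2 ENNReal.tendsto_inv_nat_nhds_zero)
      (Or.inr (by finiteness))
    rw [mul_zero] at hlim
    exact le_antisymm (ge_of_tendsto' hlim (hY.measure_exists_two_le_encard_le M)) zero_le
  have hae := ae_all_iff.2 fun M => measure_eq_zero_iff_ae_notMem.1 (hbdd M)
  filter_upwards [hae, hY.ae_pos] with ω hω hpos i j (hij : |Y i ω| = |Y j ω|)
  by_contra hne
  obtain ⟨M, hM⟩ := exists_nat_ge |Y i ω|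
  refine hω M ⟨|Y i ω|, ⟨hpos i, hM⟩, ?_⟩
  rw [← encard_pair hne]
  refine encard_le_encard ?_
  rintro k (rfl | rfl)
  exacts [rfl, hij.symm]

theorem ae_isSimpleConfig (hY : IsRadialPoisson P L ρ Y G) :
    ∀ᵐ ω ∂P, IsSimpleConfig fun i => |Y i ω| := by
  filter_upwards [hY.ae_pos, hY.ae_finite, hY.ae_injective] with ω hpos hfin hinj
  exact ⟨hpos, hfin, hinj⟩

end IsRadialPoisson

/-! ### Evaluating a right-continuous family at a random time -/

section RightContinuousFamily

/-- The cell of `(a, b]` on which the multiple `⌈t (n + 1)⌉ / (n + 1)` of `1 / (n + 1)` next to `t`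
has numerator `j`. -/
def gridCell (a b : ℝ) (n : ℕ) (j : ℤ) : Set ℝ :=
  Ioc (max a ((j - 1) / (n + 1))) (min b (j / (n + 1)))

lemma mem_gridCell {a b t : ℝ} {n : ℕ} {j : ℤ} :
    t ∈ gridCell a b n j ↔ t ∈ Ioc a b ∧ ⌈t * (n + 1)⌉ = j := by
  have hn : (0 : ℝ) < n + 1 := by positivity
  rw [Int.ceil_eq_iff, gridCell, mem_Ioc, mem_Ioc, max_lt_iff, le_min_iff, div_lt_iff₀ hn,
    le_div_iff₀ hn]
  tauto

lemma iUnion_gridCell (a b : ℝ) (n : ℕ) : ⋃ j, gridCell a b n j = Ioc a b := by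
  ext t
  simp only [mem_iUnion, mem_gridCell, exists_and_left, exists_eq', and_true]

lemma pairwise_disjoint_gridCell (a b : ℝ) (n : ℕ) :
    Pairwise (Disjoint on gridCell a b n) := fun _ _ hij =>
  disjoint_left.2 fun _ hi hj => hij ((mem_gridCell.1 hi).2.symm.trans (mem_gridCell.1 hj).2)

lemma tendsto_ceil_mul_div (t : ℝ) :
    Tendsto (fun n : ℕ => (⌈t * (n + 1)⌉ : ℝ) / (n + 1)) atTop (𝓝 t) := by
  refine tendsto_of_tendsto_of_tendsto_of_le_of_le tendsto_const_nhds
    (by simpa using tendsto_one_div_add_atTop_nhds_zero_nat.const_add t) (fun n => ?_) fun n => ?_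
  · rw [le_div_iff₀ (by positivity)]
    exact Int.le_ceil _
  · rw [div_le_iff₀ (by positivity), add_mul, inv_mul_cancel₀ (by positivity)]
    exact (Int.ceil_lt_add_one _).le

variable {α β : Type*} [MeasurableSpace α] [MeasurableSpace β] {μ : Measure α} {ν : Measure β}
  [IsFiniteMeasure μ] [IsFiniteMeasure ν] {T : α → ℝ} {U : β → ℝ} {Φ : ℝ → α → ℝ≥0∞}
  {Ψ : ℝ → β → ℝ≥0∞}

lemma tendsto_tsum_setLIntegral_gridCell (hT : Measurable T) (hΦm : ∀ c, Measurable (Φ c))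
    (hΦ1 : ∀ c x, Φ c x ≤ 1)
    (hΦc : ∀ x, ContinuousWithinAt (fun c => Φ c x) (Ici (T x)) (T x)) (a b : ℝ) :
    Tendsto (fun n : ℕ => ∑' j : ℤ,
        ∫⁻ x in T ⁻¹' gridCell a b n j, Φ (min b (j / (n + 1))) x ∂μ)
      atTop (𝓝 (∫⁻ x in T ⁻¹' Ioc a b, Φ (T x) x ∂μ)) := by
  have hcell : ∀ n j, MeasurableSet (T ⁻¹' gridCell a b n j) := fun n j => hT measurableSet_Ioc
  let F : ℕ → α → ℝ≥0∞ := fun n x => Φ (min b (⌈T x * (n + 1)⌉ / (n + 1))) x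
  have hF : ∀ n, Measurable (F n) := fun n =>
    (measurable_from_prod_countable_right
      (f := fun p : ℤ × α => Φ (min b (p.1 / (n + 1))) p.2) fun j => hΦm (min b (j / (n + 1)))).comp
      ((hT.mul_const _).ceil.prodMk measurable_id)
  have hsum : ∀ n : ℕ, ∫⁻ x in T ⁻¹' Ioc a b, F n x ∂μ
      = ∑' j : ℤ, ∫⁻ x in T ⁻¹' gridCell a b n j, Φ (min b (j / (n + 1))) x ∂μ := by
    intro n
    rw [← iUnion_gridCell a b n, preimage_iUnion, lintegral_iUnion (hcell n)
      fun i j hij => (pairwise_disjoint_gridCell a b n hij).preimage T]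
    refine tsum_congr fun j => setLIntegral_congr_fun (hcell n j) fun x hx => ?_
    simp only [F, (mem_gridCell.1 hx).2]
  refine Tendsto.congr hsum (tendsto_lintegral_of_dominated_convergence 1 hF
    (fun n => ae_of_all _ fun x => hΦ1 _ _) (by simp) ?_)
  filter_upwards [ae_restrict_mem (hT measurableSet_Ioc)] with x hx
  refine (hΦc x).tendsto.comp (tendsto_nhdsWithin_iff.2 ⟨?_, Eventually.of_forall fun n => ?_⟩)
  · simpa [min_eq_right hx.2] using tendsto_const_nhds (x := b) |>.min (tendsto_ceil_mul_div (T x))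
  · refine le_min hx.2 ?_
    rw [le_div_iff₀ (by positivity)]
    exact Int.le_ceil _

theorem setLIntegral_preimage_Ioc_eq (hT : Measurable T) (hU : Measurable U)
    (hΦm : ∀ c, Measurable (Φ c)) (hΨm : ∀ c, Measurable (Ψ c)) (hΦ1 : ∀ c x, Φ c x ≤ 1)
    (hΨ1 : ∀ c y, Ψ c y ≤ 1) (hΦc : ∀ x, ContinuousWithinAt (fun c => Φ c x) (Ici (T x)) (T x))
    (hΨc : ∀ y, ContinuousWithinAt (fun c => Ψ c y) (Ici (U y)) (U y))
    (h : ∀ c c', ∫⁻ x in T ⁻¹' Ioc c c', Φ c' x ∂μ = ∫⁻ y in U ⁻¹' Ioc c c', Ψ c' y ∂ν)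
    (a b : ℝ) :
    ∫⁻ x in T ⁻¹' Ioc a b, Φ (T x) x ∂μ = ∫⁻ y in U ⁻¹' Ioc a b, Ψ (U y) y ∂ν :=
  tendsto_nhds_unique (tendsto_tsum_setLIntegral_gridCell hT hΦm hΦ1 hΦc a b)
    ((tendsto_tsum_setLIntegral_gridCell hU hΨm hΨ1 hΨc a b).congr fun _ =>
      tsum_congr fun _ => (h _ _).symm)

end RightContinuousFamily

/-! ### Points beyond a given distance -/

section TailSum

variable {E : Type*}

lemma continuousWithinAt_measure_Ioi (m : Measure ℝ) (u : ℝ) :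
    ContinuousWithinAt (fun c => m (Ioi c)) (Ici u) u := by
  have hanti : Antitone fun c => m (Ioi c) := fun _ _ hcc => measure_mono (Ioi_subset_Ioi hcc)
  obtain ⟨v, hv, hvu, hlim⟩ := exists_seq_strictAnti_tendsto u
  have hmono : Monotone fun n => Ioi (v n) := fun _ _ hn => Ioi_subset_Ioi (hv.antitone hn)
  have hm : Tendsto (fun n => m (Ioi (v n))) atTop (𝓝 (m (Ioi u))) := by
    rw [← (isGLB_of_tendsto_atTop hv.antitone hlim).iUnion_Ioi_eq]
    exact tendsto_measure_iUnion_atTop hmono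
  refine tendsto_order.2 ⟨fun y hy => ?_, fun y hy => ?_⟩
  · obtain ⟨n, hn⟩ := (hm.eventually (lt_mem_nhds hy)).exists
    filter_upwards [nhdsWithin_le_nhds (Iio_mem_nhds (hvu n))] with c hc
    exact hn.trans_le (hanti (le_of_lt hc))
  · filter_upwards [self_mem_nhdsWithin] with c hc
    exact (hanti hc).trans_lt hy

/-- The sum of `h` over the marked points `(d i, y i)` with `c < d i`. -/
noncomputable def tailSum (h : ℝ × E → ℝ≥0∞) (d : ℕ → ℝ) (y : ℕ → E) (c : ℝ) : ℝ≥0∞ :=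
  ∑' i, (Ioi c).indicator (fun r => h (r, y i)) (d i)

lemma continuousWithinAt_tailSum (h : ℝ × E → ℝ≥0∞) (d : ℕ → ℝ) (y : ℕ → E) (u : ℝ) :
    ContinuousWithinAt (tailSum h d y) (Ici u) u := by
  have hsum : tailSum h d y
      = fun c => Measure.sum (fun i => h (d i, y i) • Measure.dirac (d i)) (Ioi c) := by
    funext c
    rw [Measure.sum_apply _ measurableSet_Ioi]
    refine tsum_congr fun i => ?_
    rw [Measure.smul_apply, Measure.dirac_apply' _ measurableSet_Ioi, smul_eq_mul]
    by_cases hi : d i ∈ Ioi c <;> simp [hi]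
  rw [hsum]
  exact continuousWithinAt_measure_Ioi _ u

variable [MeasurableSpace E]

lemma measurable_tailSum {Ω : Type*} [MeasurableSpace Ω] {Y : ℕ → Ω → ℝ} {G : ℕ → Ω → E}
    (hY : ∀ i, Measurable (Y i)) (hG : ∀ i, Measurable (G i)) {h : ℝ × E → ℝ≥0∞}
    (hh : Measurable h) {T : Ω → ℝ} (hT : Measurable T) :
    Measurable fun ω => tailSum h (fun i => |Y i ω|) (fun i => G i ω) (T ω) :=
  Measurable.tsum fun i => Measurable.indicator (hh.comp ((hY i).abs.prodMk (hG i)))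
    (measurableSet_lt hT (hY i).abs)

/-- The probability that a point at distance `r` is lost when a mark `x` is kept with probability
`exp (-h (r, x))`. -/
noncomputable def lossProb (ρ : Measure E) (h : ℝ × E → ℝ≥0∞) (r : ℝ) : ℝ≥0∞ :=
  1 - ∫⁻ x, expNeg (h (r, x)) ∂ρ

/-- The Laplace functional of the points beyond `c`. -/
noncomputable def tailLaplace (L : ℝ) (ρ : Measure E) (h : ℝ × E → ℝ≥0∞) (c : ℝ) : ℝ≥0∞ :=
  expNeg (ENNReal.ofReal L * ∫⁻ r in Ioi c, lossProb ρ h r)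

lemma continuousWithinAt_tailLaplace (L : ℝ) (ρ : Measure E) (h : ℝ × E → ℝ≥0∞) (u : ℝ) :
    ContinuousWithinAt (tailLaplace L ρ h) (Ici u) u := by
  have hint : ContinuousWithinAt (fun c => ∫⁻ r in Ioi c, lossProb ρ h r) (Ici u) u := by
    simp_rw [← withDensity_apply _ measurableSet_Ioi]
    exact continuousWithinAt_measure_Ioi _ u
  exact (continuous_expNeg.tendsto _).comp
    (ENNReal.Tendsto.const_mul hint (Or.inr ENNReal.ofReal_ne_top))

lemma measurable_tailLaplace (L : ℝ) (ρ : Measure E) (h : ℝ × E → ℝ≥0∞) :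
    Measurable (tailLaplace L ρ h) :=
  Monotone.measurable fun _ _ hcc => antitone_expNeg
    (mul_le_mul_right (lintegral_mono_set (Ioi_subset_Ioi hcc)) _)

end TailSum

section Gapped

variable {E : Type*}

/-- The functional that forbids points up to distance `a` and sums `h` beyond `b`. -/
noncomputable def gapped (h : ℝ × E → ℝ≥0∞) (a b : ℝ) (p : ℝ × E) : ℝ≥0∞ :=
  (Iic a).indicator (fun _ => ∞) p.1 + (Ioi b).indicator (fun r => h (r, p.2)) p.1

lemma expNeg_tailSum_gapped {d : ℕ → ℝ} (hd : IsSimpleConfig d) (y : ℕ → E)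
    (h : ℝ × E → ℝ≥0∞) (k : ℕ) (a b : ℝ) :
    expNeg (tailSum (gapped h a b) d y (orderStat d k))
      = (Ioi a).indicator 1 (orderStat d (k + 1))
        * expNeg (tailSum h d y (max b (orderStat d k))) := by
  by_cases ha : a < orderStat d (k + 1)
  · rw [indicator_of_mem (mem_Ioi.2 ha), Pi.one_apply, one_mul]
    rw [hd.lt_orderStat_succ_iff] at ha
    congr 1
    refine tsum_congr fun i => ?_
    by_cases hi : orderStat d k < d i
    · simp [indicator, gapped, hi, not_le.2 (ha i hi)]
    · simp [indicator, hi]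
  · rw [indicator_of_notMem (mem_Ioi.not.2 ha), zero_mul]
    rw [hd.lt_orderStat_succ_iff] at ha
    push Not at ha
    obtain ⟨i, hi, hia⟩ := ha
    rw [tailSum, ENNReal.tsum_eq_top_of_eq_top ⟨i, by simp [indicator, gapped, hi, hia]⟩,
      expNeg_top]

lemma expNeg_tailSum_gapped_eq_add {d : ℕ → ℝ} (hd : IsSimpleConfig d) (y : ℕ → E)
    (h : ℝ × E → ℝ≥0∞) (k : ℕ) {c c' : ℝ} (hcc : c ≤ c') :
    expNeg (tailSum (gapped h c c') d y (orderStat d k))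
      = expNeg (tailSum (gapped h c' c') d y (orderStat d k))
        + (Ioc c c').indicator (fun _ => expNeg (tailSum h d y c')) (orderStat d (k + 1)) := by
  rw [expNeg_tailSum_gapped hd, expNeg_tailSum_gapped hd]
  have hlt := hd.orderStat_lt_succ k
  by_cases h1 : c < orderStat d (k + 1)
  · by_cases h2 : c' < orderStat d (k + 1)
    · simp [indicator, h1, h2, not_le.2 h2]
    · simp [indicator, h1, h2, max_eq_left (hlt.le.trans (not_lt.1 h2))]
  · simp [indicator, h1, (not_lt.1 h1).trans hcc]

variable [MeasurableSpace E]

lemma measurable_gapped {h : ℝ × E → ℝ≥0∞} (hh : Measurable h) (a b : ℝ) :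
    Measurable (gapped h a b) :=
  ((measurable_const.indicator measurableSet_Iic).comp measurable_fst).add
    (hh.indicator (measurable_fst measurableSet_Ioi))

variable {ρ : Measure E} [IsProbabilityMeasure ρ]

lemma lossProb_gapped (h : ℝ × E → ℝ≥0∞) {a b : ℝ} (hab : a ≤ b) (r : ℝ) :
    lossProb ρ (gapped h a b) r
      = (Iic a).indicator 1 r + (Ioi b).indicator (lossProb ρ h) r := by
  by_cases ha : r ≤ a
  · simp [lossProb, gapped, ha, ha.trans hab]
  · by_cases hb : b < r <;> simp [lossProb, gapped, ha, hb]

lemma tailLaplace_gapped (L : ℝ) (h : ℝ × E → ℝ≥0∞) {a b : ℝ} (hab : a ≤ b) (x : ℝ) :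
    tailLaplace L ρ (gapped h a b) x
      = expNeg (ENNReal.ofReal L * ENNReal.ofReal (a - x)) * tailLaplace L ρ h (max b x) := by
  have hloss : ∫⁻ r in Ioi x, lossProb ρ (gapped h a b) r
      = ENNReal.ofReal (a - x) + ∫⁻ r in Ioi (max b x), lossProb ρ h r := by
    simp_rw [lossProb_gapped h hab]
    rw [lintegral_add_left (measurable_one.indicator measurableSet_Iic),
      lintegral_indicator_one measurableSet_Iic, lintegral_indicator measurableSet_Ioi,
      Measure.restrict_apply measurableSet_Iic, Measure.restrict_restrict measurableSet_Ioi,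
      Iic_inter_Ioi, Real.volume_Ioc, Ioi_inter_Ioi]
  rw [tailLaplace, hloss, mul_add, expNeg_add, tailLaplace]

lemma exp_add_setLIntegral_Ioc_mul_exp {L : ℝ} (hL : 0 ≤ L) (x : ℝ) {p q : ℝ} (hpq : p ≤ q) :
    ENNReal.ofReal (Real.exp (-(L * (q - x))))
        + ∫⁻ u in Ioc p q, ENNReal.ofReal (L * Real.exp (-(L * (u - x))))
      = ENNReal.ofReal (Real.exp (-(L * (p - x)))) := by
  have hcont : Continuous fun u => L * Real.exp (-(L * (u - x))) := by fun_prop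
  have hint : ∫ u in p..q, L * Real.exp (-(L * (u - x)))
      = -Real.exp (-(L * (q - x))) - -Real.exp (-(L * (p - x))) := by
    refine intervalIntegral.integral_eq_sub_of_hasDerivAt
      (f := fun u => -Real.exp (-(L * (u - x)))) (fun u _ => ?_) (hcont.intervalIntegrable _ _)
    have hexp := (((hasDerivAt_id u).sub_const x).const_mul L).neg.exp.neg
    exact hexp.congr_deriv (by simp only [Pi.neg_apply, id]; ring)
  have hnonneg : 0 ≤ ∫ u in p..q, L * Real.exp (-(L * (u - x))) :=
    intervalIntegral.integral_nonneg hpq fun u _ => by positivity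
  rw [← ofReal_integral_eq_lintegral_ofReal hcont.integrableOn_Ioc
    (ae_of_all _ fun u => by positivity), ← intervalIntegral.integral_of_le hpq,
    ← ENNReal.ofReal_add (Real.exp_pos _).le hnonneg, hint]
  congr 1
  ring

lemma expNeg_eq_add_setLIntegral {L : ℝ} (hL : 0 ≤ L) (x : ℝ) {c c' : ℝ} (hcc : c ≤ c') :
    expNeg (ENNReal.ofReal L * ENNReal.ofReal (c - x))
      = expNeg (ENNReal.ofReal L * ENNReal.ofReal (c' - x))
        + ∫⁻ u in Ioc c c' ∩ Ioi x, ENNReal.ofReal (L * Real.exp (-(L * (u - x)))) := by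
  have hset : Ioc c c' ∩ Ioi x = Ioc (max c x) (max c' x) := by
    ext u
    simp only [mem_inter_iff, mem_Ioc, mem_Ioi, max_lt_iff, le_max_iff]
    grind
  have hexp : ∀ a : ℝ, expNeg (ENNReal.ofReal L * ENNReal.ofReal (a - x))
      = ENNReal.ofReal (Real.exp (-(L * (max a x - x)))) := by
    intro a
    rw [← ENNReal.ofReal_mul hL, ← max_sub_sub_right, sub_self, mul_max_of_nonneg _ _ hL, mul_zero,
      ← expNeg_ofReal (le_max_right _ _), ENNReal.ofReal_max, ENNReal.ofReal_zero,
      max_eq_left zero_le]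
  rw [hset, hexp, hexp, exp_add_setLIntegral_Ioc_mul_exp hL x (max_le_max_right x hcc)]

lemma tailLaplace_gapped_eq_add {L : ℝ} (hL : 0 ≤ L) (h : ℝ × E → ℝ≥0∞) {c c' : ℝ}
    (hcc : c ≤ c') (x : ℝ) :
    tailLaplace L ρ (gapped h c c') x
      = tailLaplace L ρ (gapped h c' c') x
        + ∫⁻ u in Ioc c c' ∩ Ioi x,
            ENNReal.ofReal (L * Real.exp (-(L * (u - x)))) * tailLaplace L ρ h c' := by
  rw [tailLaplace_gapped L h hcc, tailLaplace_gapped L h le_rfl,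
    expNeg_eq_add_setLIntegral hL x hcc, add_mul,
    ← lintegral_mul_const' _ _ (show tailLaplace L ρ h _ ≠ ∞ from expNeg_ne_top _)]
  congr 1
  refine setLIntegral_congr_fun (measurableSet_Ioc.inter measurableSet_Ioi) fun u hu => ?_
  rw [max_eq_left ((le_of_lt hu.2).trans hu.1.2), tailLaplace]

end Gapped

/-! ### Joint law of the nearest distances and the points beyond them -/

section DistLaw

/-- The last coordinate, read as `0` in dimension `0` to match `orderStat d 0 = 0`. -/
def lastCoord : (k : ℕ) → (Fin k → ℝ) → ℝ
  | 0, _ => 0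
  | k + 1, x => x (Fin.last k)

@[fun_prop]
lemma measurable_lastCoord : ∀ k, Measurable (lastCoord k)
  | 0 => measurable_const
  | k + 1 => measurable_pi_apply (Fin.last k)

lemma lastCoord_dists {Ω : Type*} (Y : ℕ → Ω → ℝ) (k : ℕ) (ω : Ω) :
    lastCoord k (dists Y k ω) = orderStat (fun i => |Y i ω|) k := by
  cases k <;> rfl

lemma orderedRegion_zero : orderedRegion 0 = univ :=
  eq_univ_of_forall fun _ => ⟨fun i => i.elim0, fun i => i.elim0⟩

lemma mem_orderedRegion_succ {k : ℕ} {x : Fin (k + 1) → ℝ} :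
    x ∈ orderedRegion (k + 1)
      ↔ Fin.init x ∈ orderedRegion k ∧ lastCoord k (Fin.init x) < lastCoord (k + 1) x := by
  cases k with
  | zero => simp [orderedRegion, lastCoord, Subsingleton.strictMono]
  | succ k =>
    simp only [orderedRegion, mem_ofPred_eq, Fin.strictMono_iff_lt_succ, Fin.forall_fin_succ',
      Fin.init, lastCoord, Fin.succ_last, Fin.succ_castSucc]
    exact ⟨fun ⟨⟨hpos, _⟩, hmono, hlast⟩ => ⟨⟨hpos, hmono⟩, hlast⟩,
      fun ⟨⟨hpos, hmono⟩, hlast⟩ => ⟨⟨hpos, hpos.2.trans hlast⟩, hmono, hlast⟩⟩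

@[fun_prop]
lemma measurable_init {k : ℕ} : Measurable (Fin.init : (Fin (k + 1) → ℝ) → Fin k → ℝ) :=
  measurable_pi_lambda _ fun j => measurable_pi_apply j.castSucc

lemma measurableSet_orderedRegion (k : ℕ) : MeasurableSet (orderedRegion k) := by
  induction k with
  | zero => simp only [orderedRegion_zero, MeasurableSet.univ]
  | succ k ih =>
    simp only [Set.ext fun x => mem_orderedRegion_succ (k := k) (x := x)]
    exact (measurable_init ih).inter
      (measurableSet_lt ((measurable_lastCoord k).comp measurable_init)
        (measurable_lastCoord (k + 1)))

/-- The law of the `k` smallest distances of a Poisson process of rate `L` on `(0, ∞)`. -/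
noncomputable def distLaw (L : ℝ) (k : ℕ) : Measure (Fin k → ℝ) :=
  (volume.restrict (orderedRegion k)).withDensity
    fun x => ENNReal.ofReal (L ^ k * Real.exp (-(L * lastCoord k x)))

lemma lintegral_volume_pi_succ {k : ℕ} {K : ℝ × (Fin k → ℝ) → ℝ≥0∞} (hK : Measurable K) :
    ∫⁻ x : Fin (k + 1) → ℝ, K (lastCoord (k + 1) x, Fin.init x) = ∫⁻ x, ∫⁻ u, K (u, x) := by
  have hsplit := volume_preserving_piFinSuccAbove (fun _ : Fin (k + 1) => ℝ) (Fin.last k)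
  calc ∫⁻ x : Fin (k + 1) → ℝ, K (lastCoord (k + 1) x, Fin.init x)
      = ∫⁻ p, K p := by
        rw [← hsplit.lintegral_comp hK]
        exact lintegral_congr fun x => by simp [lastCoord]
    _ = ∫⁻ x, ∫⁻ u, K (u, x) := lintegral_prod_symm _ hK.aemeasurable

lemma lintegral_distLaw (L : ℝ) (k : ℕ) (f : (Fin k → ℝ) → ℝ≥0∞) :
    ∫⁻ x, f x ∂distLaw L k = ∫⁻ x, (orderedRegion k).indicator
      (fun x => ENNReal.ofReal (L ^ k * Real.exp (-(L * lastCoord k x))) * f x) x := by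
  rw [distLaw, lintegral_withDensity_eq_lintegral_mul_non_measurable _ (by fun_prop)
    (ae_of_all _ fun _ => ENNReal.ofReal_lt_top),
    ← lintegral_indicator (measurableSet_orderedRegion k)]
  rfl

theorem lintegral_distLaw_succ {L : ℝ} (hL : 0 ≤ L) {k : ℕ} {H : ℝ × (Fin k → ℝ) → ℝ≥0∞}
    (hH : Measurable H) :
    ∫⁻ x, H (lastCoord (k + 1) x, Fin.init x) ∂distLaw L (k + 1)
      = ∫⁻ x, (∫⁻ u in Ioi (lastCoord k x),
          ENNReal.ofReal (L * Real.exp (-(L * (u - lastCoord k x)))) * H (u, x)) ∂distLaw L k := by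
  let S : Set (ℝ × (Fin k → ℝ)) := {p | p.2 ∈ orderedRegion k ∧ lastCoord k p.2 < p.1}
  let K : ℝ × (Fin k → ℝ) → ℝ≥0∞ := S.indicator fun p =>
    ENNReal.ofReal (L ^ (k + 1) * Real.exp (-(L * p.1))) * H p
  have hS : MeasurableSet S := (measurable_snd (measurableSet_orderedRegion k)).inter
    (measurableSet_lt ((measurable_lastCoord k).comp measurable_snd) measurable_fst)
  have hK : Measurable K := Measurable.indicator (by fun_prop) hS
  have hleft : ∀ x, (orderedRegion (k + 1)).indicator (fun x => ENNReal.ofReal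
        (L ^ (k + 1) * Real.exp (-(L * lastCoord (k + 1) x)))
          * H (lastCoord (k + 1) x, Fin.init x)) x
      = K (lastCoord (k + 1) x, Fin.init x) := by
    intro x
    classical
    simp only [K, indicator_apply]
    exact if_congr mem_orderedRegion_succ rfl rfl
  have hdens : ∀ u y : ℝ, ENNReal.ofReal (L ^ (k + 1) * Real.exp (-(L * u)))
      = ENNReal.ofReal (L ^ k * Real.exp (-(L * y)))
        * ENNReal.ofReal (L * Real.exp (-(L * (u - y)))) := by
    intro u y
    rw [← ENNReal.ofReal_mul (by positivity), mul_mul_mul_comm, ← Real.exp_add, ← pow_succ]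
    ring_nf
  have hright : ∀ x, ∫⁻ u, K (u, x) = (orderedRegion k).indicator (fun x =>
      ENNReal.ofReal (L ^ k * Real.exp (-(L * lastCoord k x)))
        * ∫⁻ u in Ioi (lastCoord k x),
          ENNReal.ofReal (L * Real.exp (-(L * (u - lastCoord k x)))) * H (u, x)) x := by
    intro x
    by_cases hx : x ∈ orderedRegion k
    · rw [indicator_of_mem hx, ← lintegral_const_mul' _ _ ENNReal.ofReal_ne_top,
        ← lintegral_indicator measurableSet_Ioi]
      refine lintegral_congr fun u => ?_
      simp only [K, S, indicator, mem_ofPred_eq, hx, true_and, mem_Ioi, hdens u (lastCoord k x),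
        mul_assoc]
    · simp only [K, S, indicator, mem_ofPred_eq, hx, false_and, if_false, lintegral_zero]
  simp only [lintegral_distLaw, hleft]
  exact (lintegral_volume_pi_succ hK).trans (lintegral_congr hright)

lemma lintegral_Ioi_mul_exp {L : ℝ} (hL : 0 < L) (y : ℝ) :
    ∫⁻ u in Ioi y, ENNReal.ofReal (L * Real.exp (-(L * (u - y)))) = 1 := by
  have hrw : ∀ u, L * Real.exp (-(L * (u - y))) = L * Real.exp (L * y) * Real.exp (-L * u) := by
    intro u
    rw [mul_assoc, ← Real.exp_add]
    ring_nf
  simp_rw [hrw]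
  rw [← ofReal_integral_eq_lintegral_ofReal
    ((integrableOn_exp_mul_Ioi (neg_lt_zero.2 hL) y).const_mul _)
    (ae_of_all _ fun u => by positivity),
    integral_const_mul, integral_exp_mul_Ioi (neg_lt_zero.2 hL), neg_div_neg_eq, neg_mul,
    Real.exp_neg, ENNReal.ofReal_eq_one]
  field_simp

lemma isProbabilityMeasure_distLaw {L : ℝ} (hL : 0 < L) (k : ℕ) :
    IsProbabilityMeasure (distLaw L k) := by
  induction k with
  | zero => exact ⟨by simp [distLaw, orderedRegion_zero, lastCoord, volume_pi]⟩
  | succ k ih =>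
    have htotal := lintegral_distLaw_succ hL.le (k := k) (H := 1) measurable_const
    simp only [Pi.one_apply, mul_one, lintegral_Ioi_mul_exp hL, lintegral_one, measure_univ]
      at htotal
    exact ⟨htotal⟩

end DistLaw

section TailLaw

lemma isFiniteMeasure_withDensity_of_le_one {α : Type*} [MeasurableSpace α] {μ : Measure α}
    [IsFiniteMeasure μ] {f : α → ℝ≥0∞} (hf : ∀ a, f a ≤ 1) :
    IsFiniteMeasure (μ.withDensity f) :=
  isFiniteMeasure_withDensity ((lintegral_mono hf).trans_lt (by simp)).ne

lemma ext_of_lastCoord_Ioc_inter_init {k : ℕ} {μ ν : Measure (Fin (k + 1) → ℝ)}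
    [IsFiniteMeasure μ] [IsFiniteMeasure ν]
    (h : ∀ a b, ∀ A : Set (Fin k → ℝ), MeasurableSet A →
      μ (lastCoord (k + 1) ⁻¹' Ioc a b ∩ Fin.init ⁻¹' A)
        = ν (lastCoord (k + 1) ⁻¹' Ioc a b ∩ Fin.init ⁻¹' A)) :
    μ = ν := by
  have hlast := measurable_lastCoord (k + 1)
  let e := MeasurableEquiv.piFinSuccAbove (fun _ => ℝ) (Fin.last k)
  have he : ∀ s (A : Set (Fin k → ℝ)), e ⁻¹' s ×ˢ A = lastCoord (k + 1) ⁻¹' s ∩ Fin.init ⁻¹' A := by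
    intro s A
    ext x
    simp [e, lastCoord]
  refine e.map_measurableEquiv_injective (Measure.ext_prod_iff.2 fun {s A} hs hA => ?_)
  have hmap : (μ.restrict (Fin.init ⁻¹' A)).map (lastCoord (k + 1))
      = (ν.restrict (Fin.init ⁻¹' A)).map (lastCoord (k + 1)) := by
    refine Measure.ext_of_Ioc _ _ fun a b _ => ?_
    rw [Measure.map_apply hlast measurableSet_Ioc, Measure.map_apply hlast measurableSet_Ioc,
      Measure.restrict_apply (hlast measurableSet_Ioc),
      Measure.restrict_apply (hlast measurableSet_Ioc), h a b A hA]
  have hs' := congrArg (fun m => m s) hmap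
  rw [Measure.map_apply hlast hs, Measure.map_apply hlast hs, Measure.restrict_apply (hlast hs),
    Measure.restrict_apply (hlast hs)] at hs'
  rw [e.map_apply, e.map_apply, he, hs']

variable {Ω E : Type*} [MeasurableSpace Ω] [MeasurableSpace E] {P : Measure Ω} {L : ℝ}
  {ρ : Measure E} {Y : ℕ → Ω → ℝ} {G : ℕ → Ω → E}

/-- The weight `exp (-∑ h)` over the points of a configuration beyond `c`. -/
noncomputable def tailWeight (Y : ℕ → Ω → ℝ) (G : ℕ → Ω → E) (h : ℝ × E → ℝ≥0∞) (c : ℝ) (ω : Ω) :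
    ℝ≥0∞ :=
  expNeg (tailSum h (fun i => |Y i ω|) (fun i => G i ω) c)

/-- The joint law of the `k` smallest distances and of the points beyond them: given these
distances, the points beyond the `k`-th are again Poisson. -/
def HasTailLaw (P : Measure Ω) (L : ℝ) (ρ : Measure E) (Y : ℕ → Ω → ℝ) (G : ℕ → Ω → E) (k : ℕ) :
    Prop :=
  ∀ h : ℝ × E → ℝ≥0∞, Measurable h → ∀ A : Set (Fin k → ℝ), MeasurableSet A →
    ∫⁻ ω in dists Y k ⁻¹' A, tailWeight Y G h (lastCoord k (dists Y k ω)) ω ∂P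
      = ∫⁻ x in A, tailLaplace L ρ h (lastCoord k x) ∂distLaw L k

namespace IsRadialPoisson

lemma pos (hY : IsRadialPoisson P L ρ Y G) : 0 < L := by
  by_contra! hL
  have hlaplace := hY.laplace (fun _ => ∞) measurable_const
  simp [ENNReal.ofReal_of_nonpos hL, expNeg_top] at hlaplace

lemma measurable_tailWeight (hY : IsRadialPoisson P L ρ Y G) {h : ℝ × E → ℝ≥0∞}
    (hh : Measurable h) {T : Ω → ℝ} (hT : Measurable T) :
    Measurable fun ω => tailWeight Y G h (T ω) ω :=
  measurable_expNeg.comp (measurable_tailSum hY.measurable_Y hY.measurable_G hh hT)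

lemma hasTailLaw_zero (hY : IsRadialPoisson P L ρ Y G) : HasTailLaw P L ρ Y G 0 := by
  intro h hh A _
  have hlaplace := hY.laplace ((Prod.fst ⁻¹' Ioi 0).indicator h)
    (hh.indicator (measurable_fst measurableSet_Ioi))
  have hloss : ∫⁻ r in Ioi 0, (1 - ∫⁻ x, expNeg ((Prod.fst ⁻¹' Ioi 0).indicator h (r, x)) ∂ρ)
      = ∫⁻ r in Ioi 0, lossProb ρ h r :=
    setLIntegral_congr_fun measurableSet_Ioi fun r hr => by
      simp only [lossProb, indicator_of_mem (show (r, _) ∈ Prod.fst ⁻¹' Ioi (0 : ℝ) from hr)]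
  have hweight : ∫⁻ ω, tailWeight Y G h 0 ω ∂P = tailLaplace L ρ h 0 :=
    hlaplace.trans (by rw [hloss, tailLaplace])
  have := isProbabilityMeasure_distLaw hY.pos 0
  rcases Subsingleton.set_cases (p := fun A => A = ∅ ∨ A = univ) (.inl rfl) (.inr rfl) A with
    rfl | rfl
  · simp
  · simp [lastCoord, hweight]

variable [IsProbabilityMeasure P] [IsProbabilityMeasure ρ]

lemma tailWeight_gapped_eq_add (hY : IsRadialPoisson P L ρ Y G) (h : ℝ × E → ℝ≥0∞) (k : ℕ)
    {c c' : ℝ} (hcc : c ≤ c') :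
    ∀ᵐ ω ∂P, tailWeight Y G (gapped h c c') (lastCoord k (dists Y k ω)) ω
      = tailWeight Y G (gapped h c' c') (lastCoord k (dists Y k ω)) ω
        + (nthDist Y k ⁻¹' Ioc c c').indicator (tailWeight Y G h c') ω := by
  filter_upwards [hY.ae_isSimpleConfig] with ω hω
  simp only [tailWeight, lastCoord_dists]
  exact expNeg_tailSum_gapped_eq_add hω _ h k hcc

lemma setLIntegral_tailWeight_gapped (hY : IsRadialPoisson P L ρ Y G) {h : ℝ × E → ℝ≥0∞}
    (hh : Measurable h) {k : ℕ} (A : Set (Fin k → ℝ)) {c c' : ℝ} (hcc : c ≤ c') :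
    ∫⁻ ω in dists Y k ⁻¹' A, tailWeight Y G (gapped h c c') (lastCoord k (dists Y k ω)) ω ∂P
      = ∫⁻ ω in dists Y k ⁻¹' A, tailWeight Y G (gapped h c' c') (lastCoord k (dists Y k ω)) ω ∂P
        + ∫⁻ ω in nthDist Y k ⁻¹' Ioc c c', tailWeight Y G h c' ω
            ∂P.restrict (dists Y k ⁻¹' A) := by
  have hlast : Measurable fun ω => lastCoord k (dists Y k ω) :=
    (measurable_lastCoord k).comp (measurable_dists hY.measurable_Y k)
  rw [lintegral_congr_ae (ae_restrict_of_ae (hY.tailWeight_gapped_eq_add h k hcc)),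
    lintegral_add_left (hY.measurable_tailWeight (measurable_gapped hh c' c') hlast),
    lintegral_indicator (measurable_nthDist hY.measurable_Y k measurableSet_Ioc)]

lemma setLIntegral_tailLaplace_gapped (hL : 0 ≤ L) (h : ℝ × E → ℝ≥0∞) {k : ℕ}
    {A : Set (Fin k → ℝ)} (hA : MeasurableSet A) {c c' : ℝ} (hcc : c ≤ c') :
    ∫⁻ x in A, tailLaplace L ρ (gapped h c c') (lastCoord k x) ∂distLaw L k
      = ∫⁻ x in A, tailLaplace L ρ (gapped h c' c') (lastCoord k x) ∂distLaw L k
        + ∫⁻ _ in lastCoord (k + 1) ⁻¹' Ioc c c', tailLaplace L ρ h c'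
            ∂(distLaw L (k + 1)).restrict (Fin.init ⁻¹' A) := by
  simp_rw [tailLaplace_gapped_eq_add hL h hcc]
  rw [lintegral_add_left (show Measurable fun x => tailLaplace L ρ (gapped h c' c') (lastCoord k x)
    from (measurable_tailLaplace L ρ _).comp (measurable_lastCoord k))]
  congr 1
  have hIoc : MeasurableSet (lastCoord (k + 1) ⁻¹' Ioc c c') :=
    measurable_lastCoord (k + 1) measurableSet_Ioc
  have hmarkov := lintegral_distLaw_succ hL (k := k)
    (H := (Ioc c c' ×ˢ A).indicator fun _ => tailLaplace L ρ h c')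
    (measurable_const.indicator (measurableSet_Ioc.prod hA))
  rw [Measure.restrict_restrict hIoc, ← lintegral_indicator
    (hIoc.inter (measurable_init hA)), ← lintegral_indicator hA]
  refine Eq.trans (lintegral_congr fun x => ?_) hmarkov.symm
  by_cases hx : x ∈ A
  · rw [indicator_of_mem hx, ← Measure.restrict_restrict measurableSet_Ioc,
      ← lintegral_indicator measurableSet_Ioc]
    simp [indicator, hx]
  · simp [indicator, hx]

lemma setLIntegral_tailWeight_Ioc (hY : IsRadialPoisson P L ρ Y G) {k : ℕ}
    (hk : HasTailLaw P L ρ Y G k) {h : ℝ × E → ℝ≥0∞} (hh : Measurable h) {A : Set (Fin k → ℝ)}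
    (hA : MeasurableSet A) (c c' : ℝ) :
    ∫⁻ ω in nthDist Y k ⁻¹' Ioc c c', tailWeight Y G h c' ω ∂P.restrict (dists Y k ⁻¹' A)
      = ∫⁻ _ in lastCoord (k + 1) ⁻¹' Ioc c c', tailLaplace L ρ h c'
          ∂(distLaw L (k + 1)).restrict (Fin.init ⁻¹' A) := by
  rcases lt_or_ge c' c with hcc | hcc
  · simp [Ioc_eq_empty hcc.not_gt]
  have hfin : ∫⁻ x in A, tailLaplace L ρ (gapped h c' c') (lastCoord k x) ∂distLaw L k ≠ ∞ := by
    have := isProbabilityMeasure_distLaw hY.pos k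
    exact ((lintegral_mono fun _ => expNeg_le_one _).trans_lt
      (by simp)).ne
  rw [← ENNReal.add_right_inj hfin, ← setLIntegral_tailLaplace_gapped hY.pos.le h hA hcc,
    ← hk _ (measurable_gapped hh c c') A hA, ← hk _ (measurable_gapped hh c' c') A hA]
  exact (hY.setLIntegral_tailWeight_gapped hh A hcc).symm

lemma setLIntegral_tailWeight_nthDist (hY : IsRadialPoisson P L ρ Y G) {k : ℕ}
    (hk : HasTailLaw P L ρ Y G k) {h : ℝ × E → ℝ≥0∞} (hh : Measurable h) {A : Set (Fin k → ℝ)}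
    (hA : MeasurableSet A) (a b : ℝ) :
    ∫⁻ ω in nthDist Y k ⁻¹' Ioc a b, tailWeight Y G h (nthDist Y k ω) ω
        ∂P.restrict (dists Y k ⁻¹' A)
      = ∫⁻ x in lastCoord (k + 1) ⁻¹' Ioc a b, tailLaplace L ρ h (lastCoord (k + 1) x)
          ∂(distLaw L (k + 1)).restrict (Fin.init ⁻¹' A) := by
  have := isProbabilityMeasure_distLaw hY.pos (k + 1)
  exact setLIntegral_preimage_Ioc_eq (Φ := tailWeight Y G h) (Ψ := fun c _ => tailLaplace L ρ h c)
    (measurable_nthDist hY.measurable_Y k) (measurable_lastCoord (k + 1))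
    (fun _ => hY.measurable_tailWeight hh measurable_const) (fun _ => measurable_const)
    (fun _ _ => expNeg_le_one _) (fun _ _ => expNeg_le_one _)
    (fun _ => (continuous_expNeg.tendsto _).comp (continuousWithinAt_tailSum h _ _ _))
    (fun _ => continuousWithinAt_tailLaplace L ρ h _)
    (hY.setLIntegral_tailWeight_Ioc hk hh hA) a b

lemma hasTailLaw_succ (hY : IsRadialPoisson P L ρ Y G) {k : ℕ} (hk : HasTailLaw P L ρ Y G k) :
    HasTailLaw P L ρ Y G (k + 1) := by
  intro h hh B hB
  have := isProbabilityMeasure_distLaw hY.pos (k + 1)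
  have hdists := measurable_dists hY.measurable_Y (k + 1)
  let μ := P.withDensity fun ω => tailWeight Y G h (nthDist Y k ω) ω
  let ν := (distLaw L (k + 1)).withDensity fun x => tailLaplace L ρ h (lastCoord (k + 1) x)
  have : IsFiniteMeasure μ := isFiniteMeasure_withDensity_of_le_one fun _ => expNeg_le_one _
  have : IsFiniteMeasure ν := isFiniteMeasure_withDensity_of_le_one fun _ => expNeg_le_one _
  have hμν : μ.map (dists Y (k + 1)) = ν := by
    refine ext_of_lastCoord_Ioc_inter_init fun a b A hA => ?_
    have hIoc : MeasurableSet (lastCoord (k + 1) ⁻¹' Ioc a b) :=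
      measurable_lastCoord (k + 1) measurableSet_Ioc
    have hbox := hIoc.inter (measurable_init hA)
    rw [Measure.map_apply hdists hbox, withDensity_apply _ (hdists hbox), withDensity_apply _ hbox,
      ← Measure.restrict_restrict hIoc, ← hY.setLIntegral_tailWeight_nthDist hk hh hA,
      Measure.restrict_restrict (measurable_nthDist hY.measurable_Y k measurableSet_Ioc)]
    rfl
  have hB' := congrArg (fun m => m B) hμν
  rwa [Measure.map_apply hdists hB, withDensity_apply _ (hdists hB), withDensity_apply _ hB] at hB'

theorem hasTailLaw (hY : IsRadialPoisson P L ρ Y G) (k : ℕ) : HasTailLaw P L ρ Y G k := by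
  induction k with
  | zero => exact hY.hasTailLaw_zero
  | succ k ih => exact hY.hasTailLaw_succ ih

end IsRadialPoisson

end TailLaw

/-! ### Exponential gains and the closed form of the Laplace transform -/

section Exponential

variable {mu : ℝ}

lemma lintegral_expNeg_expMeasure {θ : ℝ} (hmu : 0 < mu) (hθ : 0 ≤ θ) :
    ∫⁻ x, expNeg (ENNReal.ofReal (θ * x)) ∂expMeasure mu = ENNReal.ofReal (mu / (θ + mu)) := by
  have hsum : 0 < θ + mu := by linarith
  have htilt : ∀ x, exponentialPDF mu x * expNeg (ENNReal.ofReal (θ * x))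
      = ENNReal.ofReal (mu / (θ + mu)) * exponentialPDF (θ + mu) x := by
    intro x
    rcases lt_or_ge x 0 with hx | hx
    · rw [exponentialPDF_of_neg hx, exponentialPDF_of_neg hx, zero_mul, mul_zero]
    · rw [exponentialPDF_of_nonneg hx, exponentialPDF_of_nonneg hx,
        expNeg_ofReal (mul_nonneg hθ hx), ← ENNReal.ofReal_mul (by positivity),
        ← ENNReal.ofReal_mul (by positivity), mul_assoc, ← Real.exp_add, ← mul_assoc,
        div_mul_cancel₀ _ hsum.ne']
      ring_nf
  calc ∫⁻ x, expNeg (ENNReal.ofReal (θ * x)) ∂expMeasure mu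
      = ∫⁻ x, exponentialPDF mu x * expNeg (ENNReal.ofReal (θ * x)) :=
        lintegral_withDensity_eq_lintegral_mul _ (measurable_exponentialPDFReal mu).ennreal_ofReal
          (measurable_expNeg.comp (by fun_prop))
    _ = ENNReal.ofReal (mu / (θ + mu)) := by
        simp_rw [htilt]
        rw [lintegral_const_mul' _ _ ENNReal.ofReal_ne_top, lintegral_exponentialPDF_eq_one hsum,
          mul_one]

lemma expMeasure_Ioi {a : ℝ} (hmu : 0 < mu) (ha : 0 ≤ a) :
    expMeasure mu (Ioi a) = ENNReal.ofReal (Real.exp (-(mu * a))) := by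
  have := isProbabilityMeasure_expMeasure hmu
  rw [← compl_Iic, ← ofReal_measureReal, probReal_compl_eq_one_sub measurableSet_Iic,
    ← cdf_eq_real, cdf_expMeasure_eq hmu, if_pos ha, sub_sub_cancel]

end Exponential

section Zeta

variable {lam mu Pd alpha s r : ℝ}

/-- The exponent `s * Pd * x * r ^ (-alpha)` contributed to the Laplace transform of the
interference by a station at distance `r` with gain `x`; the argument is the pair `(r, x)`. -/
noncomputable def pathLoss (Pd alpha s : ℝ) (p : ℝ × ℝ) : ℝ≥0∞ :=
  ENNReal.ofReal s * ENNReal.ofReal (Pd * p.2 * p.1 ^ (-alpha))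

lemma measurable_pathLoss (Pd alpha s : ℝ) : Measurable (pathLoss Pd alpha s) := by
  unfold pathLoss
  fun_prop

/-- The value of `lossProb` at `x` for exponential gains: the integrand of `zeta`. -/
noncomputable def expLossProb (mu Pd alpha s x : ℝ) : ℝ :=
  1 - mu / (s * Pd * x ^ (-alpha) + mu)

lemma measurable_expLossProb (mu Pd alpha : ℝ) :
    Measurable fun p : ℝ × ℝ => expLossProb mu Pd alpha p.1 p.2 := by
  unfold expLossProb
  fun_prop

lemma expLossProb_mem_Icc (hmu : 0 < mu) (hPd : 0 ≤ Pd) (hs : 0 ≤ s) {x : ℝ} (hx : 0 ≤ x) :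
    expLossProb mu Pd alpha s x ∈ Icc 0 (s * Pd / mu * x ^ (-alpha)) := by
  have ha : 0 ≤ s * Pd * x ^ (-alpha) := by positivity
  have hdiv : expLossProb mu Pd alpha s x
      = s * Pd * x ^ (-alpha) / (s * Pd * x ^ (-alpha) + mu) := by
    rw [expLossProb, one_sub_div (by positivity), add_sub_cancel_right]
  rw [hdiv, ← mul_div_right_comm]
  exact ⟨by positivity, div_le_div_of_nonneg_left ha hmu (by linarith)⟩

lemma ae_expLossProb_nonneg (hmu : 0 < mu) (hPd : 0 ≤ Pd) (hs : 0 ≤ s) (hr : 0 ≤ r) :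
    0 ≤ᵐ[volume.restrict (Ioi r)] expLossProb mu Pd alpha s := by
  filter_upwards [ae_restrict_mem measurableSet_Ioi] with x hx
  exact (expLossProb_mem_Icc hmu hPd hs (hr.trans (le_of_lt hx))).1

lemma ae_norm_expLossProb_le (hmu : 0 < mu) (hPd : 0 ≤ Pd) (hs : 0 ≤ s) (hr : 0 ≤ r) {s' : ℝ}
    (hss : s ≤ s') :
    ∀ᵐ x ∂volume.restrict (Ioi r), ‖expLossProb mu Pd alpha s x‖ ≤ s' * Pd / mu * x ^ (-alpha) := by
  filter_upwards [ae_restrict_mem measurableSet_Ioi] with x hx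
  have hx0 : 0 ≤ x := hr.trans (le_of_lt hx)
  have hloss := expLossProb_mem_Icc (alpha := alpha) hmu hPd hs hx0
  rw [Real.norm_of_nonneg hloss.1]
  exact hloss.2.trans (by gcongr)

lemma aestronglyMeasurable_expLossProb (mu Pd alpha s r : ℝ) :
    AEStronglyMeasurable (expLossProb mu Pd alpha s) (volume.restrict (Ioi r)) :=
  ((measurable_expLossProb mu Pd alpha).comp measurable_prodMk_left).aestronglyMeasurable

lemma integrableOn_Ioi_const_mul_rpow_neg (halpha : 1 < alpha) (c : ℝ) (hr : 0 < r) :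
    IntegrableOn (fun x : ℝ => c * x ^ (-alpha)) (Ioi r) :=
  (integrableOn_Ioi_rpow_of_lt (by linarith) hr).const_mul c

lemma integrableOn_expLossProb (hmu : 0 < mu) (hPd : 0 ≤ Pd) (halpha : 1 < alpha) (hs : 0 ≤ s)
    (hr : 0 < r) : IntegrableOn (expLossProb mu Pd alpha s) (Ioi r) :=
  (integrableOn_Ioi_const_mul_rpow_neg halpha (s * Pd / mu) hr).mono'
    (aestronglyMeasurable_expLossProb mu Pd alpha s r)
    (ae_norm_expLossProb_le hmu hPd hs hr.le le_rfl)

lemma lossProb_pathLoss (hmu : 0 < mu) (hPd : 0 ≤ Pd) (hs : 0 ≤ s) {x : ℝ} (hx : 0 ≤ x) :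
    lossProb (expMeasure mu) (pathLoss Pd alpha s) x
      = ENNReal.ofReal (expLossProb mu Pd alpha s x) := by
  have ha : 0 ≤ s * Pd * x ^ (-alpha) := by positivity
  have hexp : ∀ y, pathLoss Pd alpha s (x, y) = ENNReal.ofReal (s * Pd * x ^ (-alpha) * y) := by
    intro y
    rw [pathLoss, ← ENNReal.ofReal_mul hs]
    ring_nf
  simp_rw [lossProb, hexp]
  rw [lintegral_expNeg_expMeasure hmu ha, ← ENNReal.ofReal_one,
    ← ENNReal.ofReal_sub _ (by positivity), expLossProb]

lemma tailLaplace_pathLoss (hlam : 0 ≤ lam) (hmu : 0 < mu) (hPd : 0 ≤ Pd) (halpha : 1 < alpha)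
    (hs : 0 ≤ s) (hr : 0 < r) :
    tailLaplace (2 * lam) (expMeasure mu) (pathLoss Pd alpha s) r
      = ENNReal.ofReal (zeta lam mu Pd alpha s r) := by
  have hnonneg := ae_expLossProb_nonneg (alpha := alpha) hmu hPd hs hr.le
  rw [tailLaplace, setLIntegral_congr_fun measurableSet_Ioi fun x hx =>
      lossProb_pathLoss hmu hPd hs (hr.le.trans (le_of_lt hx)),
    ← ofReal_integral_eq_lintegral_ofReal (integrableOn_expLossProb hmu hPd halpha hs hr) hnonneg,
    ← ENNReal.ofReal_mul (by positivity),
    expNeg_ofReal (mul_nonneg (by positivity) (integral_nonneg_of_ae hnonneg))]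
  rfl

lemma continuousOn_zeta (lam : ℝ) (hmu : 0 < mu) (hPd : 0 ≤ Pd) (halpha : 1 < alpha) (hr : 0 < r) :
    ContinuousOn (fun s => zeta lam mu Pd alpha s r) (Ici 0) := by
  intro s hs
  have hint : ContinuousWithinAt (fun s => ∫ x in Ioi r, expLossProb mu Pd alpha s x)
      (Ici 0) s := by
    refine continuousWithinAt_of_dominated (bound := fun x => (s + 1) * Pd / mu * x ^ (-alpha))
      (Eventually.of_forall fun s' => aestronglyMeasurable_expLossProb mu Pd alpha s' r) ?_
      (integrableOn_Ioi_const_mul_rpow_neg halpha _ hr) ?_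
    · filter_upwards [self_mem_nhdsWithin,
        nhdsWithin_le_nhds (Iic_mem_nhds (show s < s + 1 by linarith))] with s' hs' hss
      exact ae_norm_expLossProb_le hmu hPd hs' hr.le hss
    · filter_upwards [ae_restrict_mem measurableSet_Ioi] with x hx
      have hx0 : 0 < x := hr.trans hx
      have hs0 : 0 ≤ s := hs
      have hne : s * Pd * x ^ (-alpha) + mu ≠ 0 := by positivity
      unfold expLossProb
      exact ContinuousAt.continuousWithinAt (by fun_prop (disch := assumption))
  exact Real.continuous_exp.continuousAt.comp_continuousWithinAt (hint.const_mul (2 * lam)).neg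

lemma zeta_zero (hmu : mu ≠ 0) : zeta lam mu Pd alpha 0 r = 1 := by
  simp [zeta, hmu]

lemma zeta_nonneg : 0 ≤ zeta lam mu Pd alpha s r := (Real.exp_pos _).le

lemma zeta_le_one (hlam : 0 ≤ lam) (hmu : 0 < mu) (hPd : 0 ≤ Pd) (hs : 0 ≤ s) (hr : 0 ≤ r) :
    zeta lam mu Pd alpha s r ≤ 1 :=
  Real.exp_le_one_iff.2 (neg_nonpos.2 (mul_nonneg (by positivity)
    (integral_nonneg_of_ae (ae_expLossProb_nonneg hmu hPd hs hr))))

lemma measurable_zeta (lam mu Pd alpha : ℝ) :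
    Measurable fun p : ℝ × ℝ => zeta lam mu Pd alpha p.1 p.2 := by
  let F : (ℝ × ℝ) × ℝ → ℝ :=
    {q | q.1.2 < q.2}.indicator fun q => expLossProb mu Pd alpha q.1.1 q.2
  have hF : Measurable F :=
    ((measurable_expLossProb mu Pd alpha).comp (g := fun p => expLossProb mu Pd alpha p.1 p.2)
      ((measurable_fst.comp measurable_fst).prodMk measurable_snd)).indicator
      (measurableSet_lt (by fun_prop) (by fun_prop))
  have hint : Measurable fun p : ℝ × ℝ => ∫ x in Ioi p.2, expLossProb mu Pd alpha p.1 x := by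
    simp_rw [← integral_indicator measurableSet_Ioi]
    exact (hF.stronglyMeasurable.integral_prod_right' (ν := volume)).measurable
  exact Real.measurable_exp.comp (hint.const_mul (2 * lam)).neg

end Zeta

/-! ### Conditional Laplace transform of the interference -/

section CondDistrib

variable {Ω α β : Type*} [MeasurableSpace Ω] [MeasurableSpace α] [MeasurableSpace β]
  [StandardBorelSpace β] [Nonempty β] {P : Measure Ω} [IsFiniteMeasure P] {X : Ω → α} {Z : Ω → β}

lemma lintegral_lintegral_condDistrib (hX : Measurable X) (hZ : Measurable Z)
    {H : α × β → ℝ≥0∞} (hH : Measurable H) :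
    ∫⁻ x, (∫⁻ z, H (x, z) ∂condDistrib Z X P x) ∂P.map X = ∫⁻ ω, H (X ω, Z ω) ∂P := by
  rw [← Measure.lintegral_compProd hH, compProd_map_condDistrib hZ.aemeasurable,
    lintegral_map hH (hX.prodMk hZ)]

lemma ae_lintegral_condDistrib_eq (hX : Measurable X) (hZ : Measurable Z) {f : β → ℝ≥0∞}
    (hf : Measurable f) {F : α → ℝ≥0∞} (hF : Measurable F)
    (h : ∀ A, MeasurableSet A → ∫⁻ ω in X ⁻¹' A, f (Z ω) ∂P = ∫⁻ x in A, F x ∂P.map X) :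
    ∀ᵐ x ∂P.map X, ∫⁻ z, f z ∂condDistrib Z X P x = F x := by
  refine ae_eq_of_forall_setLIntegral_eq_of_sigmaFinite hf.lintegral_kernel hF fun A hA _ => ?_
  have hfZ : Measurable fun p : α × β => f p.2 := hf.comp measurable_snd
  calc ∫⁻ x in A, (∫⁻ z, f z ∂condDistrib Z X P x) ∂P.map X
    _ = ∫⁻ p in A ×ˢ univ, f p.2 ∂(P.map X ⊗ₘ condDistrib Z X P) := by
      simp_rw [Measure.setLIntegral_compProd hfZ hA MeasurableSet.univ, Measure.restrict_univ]
    _ = ∫⁻ ω in X ⁻¹' A, f (Z ω) ∂P := by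
      rw [compProd_map_condDistrib hZ.aemeasurable,
        setLIntegral_map (hA.prod MeasurableSet.univ) hfZ (hX.prodMk hZ), mk_preimage_prod,
        preimage_univ, inter_univ]
    _ = ∫⁻ x in A, F x ∂P.map X := h A hA

lemma ae_ae_condDistrib_of_ae (hX : Measurable X) (hZ : Measurable Z) {p : β → Prop}
    (hp : MeasurableSet {z | p z}) (h : ∀ᵐ ω ∂P, p (Z ω)) :
    ∀ᵐ x ∂P.map X, ∀ᵐ z ∂condDistrib Z X P x, p z := by
  refine Measure.ae_ae_of_ae_compProd (p := fun q : α × β => p q.2) ?_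
  rw [compProd_map_condDistrib hZ.aemeasurable,
    ae_map_iff (hX.prodMk hZ).aemeasurable
      (show MeasurableSet {q : α × β | p q.2} from measurable_snd hp)]
  exact h

end CondDistrib

section LaplaceTransform

variable {κ : Measure ℝ}

lemma ae_norm_exp_neg_mul_le_one (hκ : ∀ᵐ u ∂κ, 0 ≤ u) {s : ℝ} (hs : 0 ≤ s) :
    ∀ᵐ u ∂κ, ‖Real.exp (-(s * u))‖ ≤ 1 := by
  filter_upwards [hκ] with u hu
  rw [Real.norm_of_nonneg (Real.exp_pos _).le]
  exact Real.exp_le_one_iff.2 (neg_nonpos.2 (mul_nonneg hs hu))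

variable [IsFiniteMeasure κ]

lemma integrable_exp_neg_mul (hκ : ∀ᵐ u ∂κ, 0 ≤ u) {s : ℝ} (hs : 0 ≤ s) :
    Integrable (fun u => Real.exp (-(s * u))) κ :=
  (integrable_const 1).mono' (by fun_prop) (ae_norm_exp_neg_mul_le_one hκ hs)

lemma continuousOn_integral_exp_neg_mul (hκ : ∀ᵐ u ∂κ, 0 ≤ u) :
    ContinuousOn (fun s => ∫ u, Real.exp (-(s * u)) ∂κ) (Ici 0) := by
  intro s _
  refine continuousWithinAt_of_dominated (bound := fun _ => 1)
    (Eventually.of_forall fun s' => by fun_prop) ?_ (integrable_const _)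
    (ae_of_all _ fun u => by fun_prop)
  filter_upwards [self_mem_nhdsWithin] with s' hs' using ae_norm_exp_neg_mul_le_one hκ hs'

lemma eqOn_Ici_of_forall_ratCast_eq {f g : ℝ → ℝ} (hf : ContinuousOn f (Ici 0))
    (hg : ContinuousOn g (Ici 0)) (h : ∀ q : ℚ, (0 : ℝ) ≤ q → f q = g q) : EqOn f g (Ici 0) := by
  have hdense : Ici (0 : ℝ) ⊆ closure (Ioi 0 ∩ range ((↑) : ℚ → ℝ)) := by
    rw [← closure_Ioi]
    exact closure_minimal (Rat.denseRange_cast.open_subset_closure_inter isOpen_Ioi)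
      isClosed_closure
  have heq : EqOn f g (Ioi 0 ∩ range ((↑) : ℚ → ℝ)) := by
    rintro _ ⟨hq, q, rfl⟩
    exact h q (le_of_lt hq)
  exact heq.of_subset_closure hf hg (inter_subset_left.trans Ioi_subset_Ici_self) hdense

end LaplaceTransform

section Interference

variable {lam mu Pd alpha : ℝ} {m : ℕ}

lemma lastCoord_pos (hm : 0 < m) {x : Fin m → ℝ} (hx : x ∈ orderedRegion m) :
    0 < lastCoord m x := by
  obtain ⟨k, rfl⟩ := Nat.exists_eq_add_one.2 hm
  exact hx.1 _

lemma ae_distLaw_iff {L : ℝ} (hL : 0 < L) {p : (Fin m → ℝ) → Prop} :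
    (∀ᵐ x ∂distLaw L m, p x) ↔ ∀ᵐ x ∂volume.restrict (orderedRegion m), p x := by
  rw [distLaw, ae_withDensity_iff (by fun_prop)]
  have hdens (x : Fin m → ℝ) : ENNReal.ofReal (L ^ m * Real.exp (-(L * lastCoord m x))) ≠ 0 :=
    (ENNReal.ofReal_pos.2 (by positivity)).ne'
  simp only [hdens, ne_eq, not_false_eq_true, forall_const]

lemma ae_distLaw_mem (L : ℝ) (m : ℕ) : ∀ᵐ x ∂distLaw L m, x ∈ orderedRegion m :=
  (withDensity_absolutelyContinuous _ _).ae_le (ae_restrict_mem (measurableSet_orderedRegion m))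

lemma measurable_zeta_lastCoord (lam mu Pd alpha s : ℝ) (m : ℕ) :
    Measurable fun x : Fin m → ℝ => ENNReal.ofReal (zeta lam mu Pd alpha s (lastCoord m x)) :=
  ((measurable_zeta lam mu Pd alpha).comp
    (measurable_const.prodMk (measurable_lastCoord m))).ennreal_ofReal

lemma tendsto_lintegral_zeta_distLaw (hlam : 0 < lam) (hmu : 0 < mu) (hPd : 0 ≤ Pd)
    (halpha : 1 < alpha) (hm : 0 < m) :
    Tendsto (fun n : ℕ => ∫⁻ x, ENNReal.ofReal
      (zeta lam mu Pd alpha (1 / ((n : ℝ) + 1)) (lastCoord m x)) ∂distLaw (2 * lam) m)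
      atTop (𝓝 1) := by
  have := isProbabilityMeasure_distLaw (mul_pos two_pos hlam) m
  have hinv : Tendsto (fun n : ℕ => 1 / ((n : ℝ) + 1)) atTop (𝓝[Ici 0] 0) :=
    tendsto_nhdsWithin_iff.2 ⟨tendsto_one_div_add_atTop_nhds_zero_nat,
      Eventually.of_forall fun n => mem_Ici.2 (by positivity)⟩
  rw [← show ∫⁻ _, 1 ∂distLaw (2 * lam) m = 1 by simp]
  refine tendsto_lintegral_of_dominated_convergence (fun _ => 1)
    (fun n => measurable_zeta_lastCoord _ _ _ _ _ m) (fun n => ?_) (by simp) ?_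
  · filter_upwards [ae_distLaw_mem (2 * lam) m] with x hx
    exact ENNReal.ofReal_le_one.2
      (zeta_le_one hlam.le hmu hPd (by positivity) (lastCoord_pos hm hx).le)
  · filter_upwards [ae_distLaw_mem (2 * lam) m] with x hx
    have hcont := continuousOn_zeta lam hmu hPd halpha (lastCoord_pos hm hx) 0 self_mem_Ici
    simpa [zeta_zero hmu.ne'] using ENNReal.tendsto_ofReal (hcont.tendsto.comp hinv)

/-- A regular conditional distribution of the interference given the `m` smallest distances. -/
noncomputable abbrev condInterference {Ω : Type*} [MeasurableSpace Ω] (P : Measure Ω)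
    [IsFiniteMeasure P] (Pd alpha : ℝ) (Y G : ℕ → Ω → ℝ) (m : ℕ) : Kernel (Fin m → ℝ) ℝ :=
  condDistrib (fun ω => (interference Pd alpha Y G m ω).toReal) (dists Y m) P

namespace IsRadialPoisson

variable {Ω E : Type*} [MeasurableSpace Ω] [MeasurableSpace E] {P : Measure Ω}

lemma measurable_toReal_interference {L : ℝ} {ρ : Measure ℝ} {Y G : ℕ → Ω → ℝ}
    (hY : IsRadialPoisson P L ρ Y G) (Pd alpha : ℝ) (m : ℕ) :
    Measurable fun ω => (interference Pd alpha Y G m ω).toReal :=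
  (measurable_interference hY.measurable_Y hY.measurable_G Pd alpha m).ennreal_toReal

variable [IsProbabilityMeasure P]

theorem hasLaw_dists {L : ℝ} {ρ : Measure E} [IsProbabilityMeasure ρ] {Y : ℕ → Ω → ℝ}
    {G : ℕ → Ω → E} (hY : IsRadialPoisson P L ρ Y G) (m : ℕ) :
    HasLaw (dists Y m) (distLaw L m) P := by
  have hdists := measurable_dists hY.measurable_Y m
  refine ⟨hdists.aemeasurable, Measure.ext fun A hA => ?_⟩
  have htail := hY.hasTailLaw m (fun _ => 0) measurable_const A hA
  simp only [tailWeight, tailSum, tailLaplace, lossProb, indicator_zero, tsum_zero, expNeg_zero,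
    lintegral_const, measure_univ, one_mul, tsub_self, zero_mul, mul_zero,
    Measure.restrict_apply_univ] at htail
  rw [Measure.map_apply hdists hA, htail]

variable {Y G : ℕ → Ω → ℝ}

lemma tailWeight_pathLoss {L : ℝ} {ρ : Measure ℝ} [IsProbabilityMeasure ρ]
    (hY : IsRadialPoisson P L ρ Y G) (hm : 0 < m) (s : ℝ) :
    ∀ᵐ ω ∂P, tailWeight Y G (pathLoss Pd alpha s) (lastCoord m (dists Y m ω)) ω
      = expNeg (ENNReal.ofReal s * interference Pd alpha Y G m ω) := by
  filter_upwards [hY.ae_isSimpleConfig] with ω hω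
  rw [tailWeight, tailSum, interference_eq_tsum, ← ENNReal.tsum_mul_left]
  congr 1
  refine tsum_congr fun i => ?_
  have hiff : i ∈ (cooperating Y m ω)ᶜ ↔ |Y i ω| ∈ Ioi (lastCoord m (dists Y m ω)) := by
    rw [lastCoord_dists, mem_Ioi, ← hω.le_encard_lt_iff hm, ← not_lt]
    rfl
  by_cases hi : i ∈ (cooperating Y m ω)ᶜ
  · rw [indicator_of_mem hi, indicator_of_mem (hiff.1 hi)]
    rfl
  · rw [indicator_of_notMem hi, indicator_of_notMem (hiff.not.1 hi), mul_zero]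

lemma setLIntegral_expNeg_interference (hY : IsRadialPoisson P (2 * lam) (expMeasure mu) Y G)
    (hmu : 0 < mu) (hPd : 0 ≤ Pd) (halpha : 1 < alpha) (hm : 0 < m) {s : ℝ} (hs : 0 ≤ s)
    {A : Set (Fin m → ℝ)} (hA : MeasurableSet A) :
    ∫⁻ ω in dists Y m ⁻¹' A, expNeg (ENNReal.ofReal s * interference Pd alpha Y G m ω) ∂P
      = ∫⁻ x in A, ENNReal.ofReal (zeta lam mu Pd alpha s (lastCoord m x))
          ∂distLaw (2 * lam) m := by
  have := isProbabilityMeasure_expMeasure hmu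
  have hlam : 0 < lam := by linarith [hY.pos]
  rw [← lintegral_congr_ae (ae_restrict_of_ae (hY.tailWeight_pathLoss hm s)),
    hY.hasTailLaw m _ (measurable_pathLoss Pd alpha s) A hA]
  refine lintegral_congr_ae (ae_restrict_of_ae ?_)
  filter_upwards [ae_distLaw_mem (2 * lam) m] with x hx
  exact tailLaplace_pathLoss hlam.le hmu hPd halpha hs (lastCoord_pos hm hx)

theorem ae_interference_lt_top (hY : IsRadialPoisson P (2 * lam) (expMeasure mu) Y G)
    (hmu : 0 < mu) (hPd : 0 ≤ Pd) (halpha : 1 < alpha) (hm : 0 < m) :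
    ∀ᵐ ω ∂P, interference Pd alpha Y G m ω < ∞ := by
  have hlam : 0 < lam := by linarith [hY.pos]
  have hpos (n : ℕ) : (0 : ℝ) < 1 / ((n : ℝ) + 1) := by positivity
  refine ae_lt_top_of_tendsto_lintegral_expNeg
    (measurable_interference hY.measurable_Y hY.measurable_G Pd alpha m)
    (y := fun n => ENNReal.ofReal (1 / ((n : ℝ) + 1)))
    (fun n => (ENNReal.ofReal_pos.2 (hpos n)).ne') ?_
  have hlaplace (n : ℕ) :=
    hY.setLIntegral_expNeg_interference hmu hPd halpha hm (hpos n).le MeasurableSet.univ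
  simp only [preimage_univ, Measure.restrict_univ] at hlaplace
  simpa only [hlaplace] using tendsto_lintegral_zeta_distLaw hlam hmu hPd halpha hm

lemma ae_lintegral_condInterference (hY : IsRadialPoisson P (2 * lam) (expMeasure mu) Y G)
    (hmu : 0 < mu) (hPd : 0 ≤ Pd) (halpha : 1 < alpha) (hm : 0 < m) {s : ℝ} (hs : 0 ≤ s) :
    ∀ᵐ x ∂distLaw (2 * lam) m,
      ∫⁻ u, ENNReal.ofReal (Real.exp (-(s * u))) ∂condInterference P Pd alpha Y G m x
        = ENNReal.ofReal (zeta lam mu Pd alpha s (lastCoord m x)) := by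
  have := isProbabilityMeasure_expMeasure hmu
  rw [← (hY.hasLaw_dists m).map_eq]
  refine ae_lintegral_condDistrib_eq (measurable_dists hY.measurable_Y m)
    (hY.measurable_toReal_interference Pd alpha m) (by fun_prop)
    (measurable_zeta_lastCoord lam mu Pd alpha s m) fun A hA => ?_
  rw [(hY.hasLaw_dists m).map_eq,
    ← hY.setLIntegral_expNeg_interference hmu hPd halpha hm hs hA]
  refine lintegral_congr_ae (ae_restrict_of_ae ?_)
  filter_upwards [hY.ae_interference_lt_top hmu hPd halpha hm] with ω hω
  rw [← expNeg_ofReal (mul_nonneg hs ENNReal.toReal_nonneg), ENNReal.ofReal_mul hs,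
    ENNReal.ofReal_toReal hω.ne]

lemma ae_condInterference_nonneg (hY : IsRadialPoisson P (2 * lam) (expMeasure mu) Y G)
    (hmu : 0 < mu) (Pd alpha : ℝ) (m : ℕ) :
    ∀ᵐ x ∂distLaw (2 * lam) m, ∀ᵐ u ∂condInterference P Pd alpha Y G m x, 0 ≤ u := by
  have := isProbabilityMeasure_expMeasure hmu
  rw [← (hY.hasLaw_dists m).map_eq]
  exact ae_ae_condDistrib_of_ae (measurable_dists hY.measurable_Y m)
    (hY.measurable_toReal_interference Pd alpha m) measurableSet_Ici
    (ae_of_all _ fun ω => ENNReal.toReal_nonneg)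

theorem ae_integral_condInterference (hY : IsRadialPoisson P (2 * lam) (expMeasure mu) Y G)
    (hmu : 0 < mu) (hPd : 0 ≤ Pd) (halpha : 1 < alpha) (hm : 0 < m) :
    ∀ᵐ x ∂distLaw (2 * lam) m, ∀ s : ℝ, 0 ≤ s →
      ∫ u, Real.exp (-(s * u)) ∂condInterference P Pd alpha Y G m x
        = zeta lam mu Pd alpha s (lastCoord m x) := by
  have hrat : ∀ᵐ x ∂distLaw (2 * lam) m, ∀ q : ℚ, (0 : ℝ) ≤ q →
      ∫⁻ u, ENNReal.ofReal (Real.exp (-(q * u))) ∂condInterference P Pd alpha Y G m x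
        = ENNReal.ofReal (zeta lam mu Pd alpha q (lastCoord m x)) :=
    ae_all_iff.2 fun q => eventually_imp_distrib_left.2 fun hq =>
      hY.ae_lintegral_condInterference hmu hPd halpha hm hq
  filter_upwards [hrat, hY.ae_condInterference_nonneg hmu Pd alpha m,
    ae_distLaw_mem (2 * lam) m] with x hx hnonneg hmem
  refine eqOn_Ici_of_forall_ratCast_eq (continuousOn_integral_exp_neg_mul hnonneg)
    (continuousOn_zeta lam hmu hPd halpha (lastCoord_pos hm hmem)) fun q hq => ?_
  rw [integral_eq_lintegral_of_nonneg_ae (ae_of_all _ fun u => (Real.exp_pos _).le) (by fun_prop),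
    hx q hq, ENNReal.toReal_ofReal zeta_nonneg]

end IsRadialPoisson

end Interference

/-! ### Coverage probability -/

section Coverage

variable {lam mu t Pd alpha sig2 : ℝ} {m : ℕ}

lemma ofReal_lt_ofReal_div_ofReal_iff {a b : ℝ} (ht : 0 ≤ t) (hb : 0 ≤ b) :
    ENNReal.ofReal t < ENNReal.ofReal a / ENNReal.ofReal b ↔ t * b < a := by
  rw [ENNReal.lt_div_iff_mul_lt (.inr ENNReal.ofReal_ne_top) (.inl ENNReal.ofReal_ne_top),
    ← ENNReal.ofReal_mul ht, ENNReal.ofReal_lt_ofReal_iff_of_nonneg (mul_nonneg ht hb)]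

/-- The gain that the useful signal must exceed to reach the SINR `t`, given the pair of the
distances of the cooperating stations and of the interference. -/
noncomputable def gainThreshold (t Pd alpha sig2 : ℝ) (p : (Fin m → ℝ) × ℝ) : ℝ :=
  t * (p.2 + sig2) / ∑ k, Pd * p.1 k ^ (-alpha)

lemma measurable_gainThreshold (t Pd alpha sig2 : ℝ) :
    Measurable (gainThreshold t Pd alpha sig2 : (Fin m → ℝ) × ℝ → ℝ) := by
  unfold gainThreshold
  fun_prop

lemma gainThreshold_nonneg (ht : 0 ≤ t) (hPd : 0 ≤ Pd) (hsig2 : 0 ≤ sig2) {x : Fin m → ℝ}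
    (hx : ∀ k, 0 ≤ x k) {u : ℝ} (hu : 0 ≤ u) : 0 ≤ gainThreshold t Pd alpha sig2 (x, u) :=
  div_nonneg (mul_nonneg ht (add_nonneg hu hsig2))
    (Finset.sum_nonneg fun k _ => mul_nonneg hPd (Real.rpow_nonneg (hx k) _))

lemma mul_gainThreshold (mu t Pd alpha sig2 : ℝ) (x : Fin m → ℝ) (u : ℝ) :
    mu * gainThreshold t Pd alpha sig2 (x, u)
      = jArg mu t Pd alpha x * u + jArg mu t Pd alpha x * sig2 := by
  unfold gainThreshold jArg
  ring

lemma lt_sinr_iff {Ω : Type*} {Y G : ℕ → Ω → ℝ} {g : Ω → ℝ} {ω : Ω} (ht : 0 ≤ t)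
    (hsig2 : 0 ≤ sig2) (hI : interference Pd alpha Y G m ω < ∞)
    (hgain : 0 < ∑ k, Pd * dists Y m ω k ^ (-alpha)) :
    ENNReal.ofReal t < sinr Pd alpha sig2 Y G g m ω ↔
      gainThreshold t Pd alpha sig2 (dists Y m ω, (interference Pd alpha Y G m ω).toReal)
        < g ω := by
  have hsignal : ∑ k, Pd * g ω * dists Y m ω k ^ (-alpha)
      = g ω * ∑ k, Pd * dists Y m ω k ^ (-alpha) := by
    rw [Finset.mul_sum]
    exact Finset.sum_congr rfl fun k _ => by ring
  rw [sinr, hsignal, ← ENNReal.ofReal_toReal hI.ne,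
    ← ENNReal.ofReal_add ENNReal.toReal_nonneg hsig2,
    ofReal_lt_ofReal_div_ofReal_iff ht (add_nonneg ENNReal.toReal_nonneg hsig2), gainThreshold,
    div_lt_iff₀ hgain, ENNReal.ofReal_toReal hI.ne]

lemma measurable_jArg (mu t Pd alpha : ℝ) :
    Measurable (jArg mu t Pd alpha : (Fin m → ℝ) → ℝ) := by
  unfold jArg
  fun_prop

lemma jArg_nonneg (hmu : 0 ≤ mu) (ht : 0 ≤ t) (hPd : 0 ≤ Pd) {x : Fin m → ℝ}
    (hx : ∀ k, 0 ≤ x k) : 0 ≤ jArg mu t Pd alpha x :=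
  div_nonneg (mul_nonneg hmu ht)
    (Finset.sum_nonneg fun k _ => mul_nonneg hPd (Real.rpow_nonneg (hx k) _))

/-- The coverage probability given the distances `x` of the cooperating stations. -/
noncomputable def condCoverage (lam mu t Pd alpha sig2 : ℝ) (x : Fin m → ℝ) : ℝ :=
  zeta lam mu Pd alpha (jArg mu t Pd alpha x) (lastCoord m x)
    * Real.exp (-(jArg mu t Pd alpha x * sig2))

lemma measurable_condCoverage (lam mu t Pd alpha sig2 : ℝ) :
    Measurable (condCoverage lam mu t Pd alpha sig2 : (Fin m → ℝ) → ℝ) :=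
  ((measurable_zeta lam mu Pd alpha).comp
    ((measurable_jArg mu t Pd alpha).prodMk (measurable_lastCoord m))).mul
    (Real.measurable_exp.comp ((measurable_jArg mu t Pd alpha).mul_const sig2).neg)

lemma condCoverage_nonneg (x : Fin m → ℝ) : 0 ≤ condCoverage lam mu t Pd alpha sig2 x :=
  mul_nonneg zeta_nonneg (Real.exp_pos _).le

lemma condCoverage_le_one (hlam : 0 ≤ lam) (hmu : 0 < mu) (hPd : 0 ≤ Pd) (hsig2 : 0 ≤ sig2)
    (ht : 0 ≤ t) (hm : 0 < m) {x : Fin m → ℝ} (hx : x ∈ orderedRegion m) :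
    condCoverage lam mu t Pd alpha sig2 x ≤ 1 := by
  have hj : 0 ≤ jArg mu t Pd alpha x := jArg_nonneg hmu.le ht hPd fun k => (hx.1 k).le
  exact mul_le_one₀ (zeta_le_one hlam hmu hPd hj (lastCoord_pos hm hx).le) (Real.exp_pos _).le
    (Real.exp_le_one_iff.2 (neg_nonpos.2 (mul_nonneg hj hsig2)))

lemma integrable_distLaw_iff {L : ℝ} (hL : 0 ≤ L) {φ : (Fin m → ℝ) → ℝ} :
    Integrable φ (distLaw L m) ↔ IntegrableOn
      (fun x => φ x * (L ^ m * Real.exp (-(L * lastCoord m x)))) (orderedRegion m) := by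
  have hdens (x : Fin m → ℝ) : 0 ≤ L ^ m * Real.exp (-(L * lastCoord m x)) := by positivity
  rw [distLaw, integrable_withDensity_iff (by fun_prop)
    (ae_of_all _ fun _ => ENNReal.ofReal_lt_top)]
  simp only [ENNReal.toReal_ofReal (hdens _), IntegrableOn]

lemma integral_distLaw {L : ℝ} (hL : 0 ≤ L) (φ : (Fin m → ℝ) → ℝ) :
    ∫ x, φ x ∂distLaw L m
      = ∫ x in orderedRegion m, φ x * (L ^ m * Real.exp (-(L * lastCoord m x))) := by
  have hdens (x : Fin m → ℝ) : 0 ≤ L ^ m * Real.exp (-(L * lastCoord m x)) := by positivity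
  rw [distLaw, integral_withDensity_eq_integral_toReal_smul (by fun_prop)
    (ae_of_all _ fun _ => ENNReal.ofReal_lt_top)]
  simp only [ENNReal.toReal_ofReal (hdens _), smul_eq_mul, mul_comm]

lemma integrable_condCoverage (hlam : 0 < lam) (hmu : 0 < mu) (hPd : 0 ≤ Pd)
    (hsig2 : 0 ≤ sig2) (ht : 0 ≤ t) (hm : 0 < m) :
    Integrable (condCoverage lam mu t Pd alpha sig2) (distLaw (2 * lam) m) := by
  have := isProbabilityMeasure_distLaw (mul_pos two_pos hlam) m
  refine (integrable_const 1).mono' (measurable_condCoverage ..).aestronglyMeasurable ?_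
  filter_upwards [ae_distLaw_mem (2 * lam) m] with x hx
  rw [Real.norm_of_nonneg (condCoverage_nonneg x)]
  exact condCoverage_le_one hlam.le hmu hPd hsig2 ht hm hx

lemma measure_lt_of_indepFun_expMeasure {Ω α : Type*} [MeasurableSpace Ω] [MeasurableSpace α]
    {P : Measure Ω} [IsProbabilityMeasure P] (hmu : 0 < mu) {Z : Ω → α} {g : Ω → ℝ}
    (hZ : Measurable Z) (hg : Measurable g) (hlaw : P.map g = expMeasure mu)
    (hind : IndepFun Z g P) {a : α → ℝ} (ha : Measurable a) (ha0 : ∀ᵐ ω ∂P, 0 ≤ a (Z ω)) :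
    P {ω | a (Z ω) < g ω} = ∫⁻ ω, ENNReal.ofReal (Real.exp (-(mu * a (Z ω)))) ∂P := by
  let S : Set (α × ℝ) := {p | a p.1 < p.2}
  have hS : MeasurableSet S := measurableSet_lt (ha.comp measurable_fst) measurable_snd
  calc P {ω | a (Z ω) < g ω}
    _ = ∫⁻ ω, S.indicator 1 (Z ω, g ω) ∂P :=
      (lintegral_indicator_one (hS.preimage (hZ.prodMk hg))).symm
    _ = ∫⁻ ω, expMeasure mu (Ioi (a (Z ω))) ∂P := by
      rw [lintegral_comp_prodMk_of_indepFun hZ hg hind (measurable_one.indicator hS), hlaw]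
      exact lintegral_congr fun ω => lintegral_indicator_one (s := Ioi (a (Z ω))) measurableSet_Ioi
    _ = ∫⁻ ω, ENNReal.ofReal (Real.exp (-(mu * a (Z ω)))) ∂P :=
      lintegral_congr_ae (ha0.mono fun ω hω => expMeasure_Ioi hmu hω)

variable {Ω : Type*} [MeasurableSpace Ω] {P : Measure Ω} [IsProbabilityMeasure P]

namespace IsRadialPoisson

variable {Y G : ℕ → Ω → ℝ}

lemma ae_dists_mem_orderedRegion {L : ℝ} {ρ : Measure ℝ} [IsProbabilityMeasure ρ]
    (hY : IsRadialPoisson P L ρ Y G) (m : ℕ) : ∀ᵐ ω ∂P, dists Y m ω ∈ orderedRegion m := by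
  refine ae_of_ae_map (hY.hasLaw_dists m).aemeasurable ?_
  rw [(hY.hasLaw_dists m).map_eq]
  exact ae_distLaw_mem L m

lemma ae_lintegral_gainThreshold_condInterference
    (hY : IsRadialPoisson P (2 * lam) (expMeasure mu) Y G) (hmu : 0 < mu) (hPd : 0 ≤ Pd)
    (halpha : 1 < alpha) (ht : 0 ≤ t) (hm : 0 < m) (sig2 : ℝ) :
    ∀ᵐ x ∂distLaw (2 * lam) m,
      ∫⁻ u, ENNReal.ofReal (Real.exp (-(mu * gainThreshold t Pd alpha sig2 (x, u))))
          ∂condInterference P Pd alpha Y G m x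
        = ENNReal.ofReal (condCoverage lam mu t Pd alpha sig2 x) := by
  filter_upwards [hY.ae_integral_condInterference hmu hPd halpha hm,
    hY.ae_condInterference_nonneg hmu Pd alpha m, ae_distLaw_mem (2 * lam) m]
    with x hlaplace hnonneg hx
  have hj : 0 ≤ jArg mu t Pd alpha x := jArg_nonneg hmu.le ht hPd fun k => (hx.1 k).le
  rw [condCoverage, ← hlaplace _ hj, ← integral_mul_const, ofReal_integral_eq_lintegral_ofReal
    ((integrable_exp_neg_mul hnonneg hj).mul_const _) (ae_of_all _ fun u => by positivity)]
  simp_rw [mul_gainThreshold, neg_add, Real.exp_add]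

end IsRadialPoisson

namespace IsDownlink

variable {lamd w : ℝ} {v : ℝ≥0} {X chi G : ℕ → Ω → ℝ} {g : Ω → ℝ}

lemma indepFun_prodMk_dists_interference (hnet : IsDownlink P lamd mu w v X chi G g)
    (Pd alpha : ℝ) (m : ℕ) :
    IndepFun (fun ω => (dists (displaced alpha X chi) m ω,
      (interference Pd alpha (displaced alpha X chi) G m ω).toReal)) g P := by
  have hind : IndepFun (fun ω => (((fun i => X i ω), fun i => chi i ω), fun i => G i ω)) g P :=
    indepFun_prodMk_left
      ((measurable_pi_lambda _ hnet.poisson.measurable).prodMk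
        (measurable_pi_lambda _ hnet.chi_measurable))
      (measurable_pi_lambda _ hnet.G_measurable) hnet.g_measurable hnet.indepFun_prodMk_X_chi
      hnet.indep_G
  let Y' : ℕ → ((ℕ → ℝ) × (ℕ → ℝ)) × (ℕ → ℝ) → ℝ :=
    displaced alpha (fun i p => p.1.1 i) fun i p => p.1.2 i
  let G' : ℕ → ((ℕ → ℝ) × (ℕ → ℝ)) × (ℕ → ℝ) → ℝ := fun i p => p.2 i
  have hY' : ∀ i, Measurable (Y' i) := measurable_displaced (by fun_prop) (by fun_prop) alpha
  exact hind.comp (φ := fun p => (dists Y' m p, (interference Pd alpha Y' G' m p).toReal))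
    ((measurable_dists hY' m).prodMk
      (measurable_interference hY' (by fun_prop) Pd alpha m).ennreal_toReal) measurable_id

theorem measure_lt_sinr (hnet : IsDownlink P lamd mu w v X chi G g) (hlamd : 0 < lamd)
    (hmu : 0 < mu) (hPd : 0 < Pd) (halpha : 1 < alpha) (hsig2 : 0 ≤ sig2) (ht : 0 ≤ t)
    (hm : 0 < m) :
    P {ω | ENNReal.ofReal t < sinr Pd alpha sig2 (displaced alpha X chi) G g m ω}
      = ∫⁻ x, ENNReal.ofReal (condCoverage (lamD lamd alpha w v) mu t Pd alpha sig2 x)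
          ∂distLaw (2 * lamD lamd alpha w v) m := by
  have := isProbabilityMeasure_expMeasure hmu
  have hY := hnet.isRadialPoisson hlamd.le hmu alpha
  set Y := displaced alpha X chi
  let I : Ω → ℝ := fun ω => (interference Pd alpha Y G m ω).toReal
  have hdists : Measurable (dists Y m) := measurable_dists hY.measurable_Y m
  have hI : Measurable I := hY.measurable_toReal_interference Pd alpha m
  have hthreshold := measurable_gainThreshold (m := m) t Pd alpha sig2
  have hmem := hY.ae_dists_mem_orderedRegion m
  have : Nonempty (Fin m) := ⟨⟨0, hm⟩⟩
  calc P {ω | ENNReal.ofReal t < sinr Pd alpha sig2 Y G g m ω}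
    _ = P {ω | gainThreshold t Pd alpha sig2 (dists Y m ω, I ω) < g ω} := by
      refine measure_congr ?_
      filter_upwards [hmem, hY.ae_interference_lt_top hmu hPd.le halpha hm] with ω hω hfin
      exact propext (lt_sinr_iff ht hsig2 hfin (Finset.sum_pos
        (fun k _ => mul_pos hPd (Real.rpow_pos_of_pos (hω.1 k) _)) Finset.univ_nonempty))
    _ = ∫⁻ ω, ENNReal.ofReal (Real.exp (-(mu * gainThreshold t Pd alpha sig2
          (dists Y m ω, I ω)))) ∂P :=
      measure_lt_of_indepFun_expMeasure hmu (hdists.prodMk hI) hnet.g_measurable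
        hnet.g_law.map_eq (hnet.indepFun_prodMk_dists_interference Pd alpha m) hthreshold
        (hmem.mono fun ω hω => gainThreshold_nonneg ht hPd.le hsig2 (fun k => (hω.1 k).le)
          ENNReal.toReal_nonneg)
    _ = _ := by
      rw [← lintegral_lintegral_condDistrib hdists hI
        (H := fun p => ENNReal.ofReal (Real.exp (-(mu * gainThreshold t Pd alpha sig2 p))))
        (by fun_prop), (hY.hasLaw_dists m).map_eq]
      exact lintegral_congr_ae
        (hY.ae_lintegral_gainThreshold_condInterference hmu hPd.le halpha ht hm sig2)

theorem measureReal_lt_sinr (hnet : IsDownlink P lamd mu w v X chi G g) (hlamd : 0 < lamd)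
    (hmu : 0 < mu) (hPd : 0 < Pd) (halpha : 1 < alpha) (hsig2 : 0 ≤ sig2) (ht : 0 ≤ t)
    (hm : 0 < m) :
    P.real {ω | ENNReal.ofReal t < sinr Pd alpha sig2 (displaced alpha X chi) G g m ω}
      = ∫ x, condCoverage (lamD lamd alpha w v) mu t Pd alpha sig2 x
          ∂distLaw (2 * lamD lamd alpha w v) m := by
  rw [measureReal_def, hnet.measure_lt_sinr hlamd hmu hPd halpha hsig2 ht hm,
    ← integral_eq_lintegral_of_nonneg_ae (ae_of_all _ condCoverage_nonneg)
      (measurable_condCoverage ..).aestronglyMeasurable]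

end IsDownlink

end Coverage

end CV2X

theorem theorem1_general {Ω : Type*} [MeasurableSpace Ω] (P : Measure Ω) [IsProbabilityMeasure P]
    (m : ℕ) (hm : 0 < m)
    (lamd mu Pd alpha sig2 w t : ℝ) (v : ℝ≥0)
    (hlamd : 0 < lamd) (hmu : 0 < mu) (hPd : 0 < Pd) (halpha : 1 < alpha)
    (hsig2 : 0 ≤ sig2) (ht : 0 ≤ t)
    (X chi G : ℕ → Ω → ℝ) (g : Ω → ℝ)
    (hnet : CV2X.IsDownlink P lamd mu w v X chi G g) :
    let Y : ℕ → Ω → ℝ := CV2X.displaced alpha X chi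
    let lam : ℝ := CV2X.lamD lamd alpha w v
    let I : Ω → ℝ≥0∞ := CV2X.interference Pd alpha Y G m
    let last : Fin m := ⟨m - 1, Nat.sub_one_lt_of_lt hm⟩
    let f : (Fin m → ℝ) → ℝ := fun x => CV2X.jointDensity lam m (x last)
    HasLaw (CV2X.dists Y m)
      ((volume.restrict (CV2X.orderedRegion m)).withDensity (fun x => ENNReal.ofReal (f x))) P ∧
    AEMeasurable I P ∧ (∀ᵐ ω ∂P, I ω < ∞) ∧
    (∀ᵐ x ∂(volume.restrict (CV2X.orderedRegion m)), ∀ s : ℝ, 0 ≤ s →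
      ∫ u, Real.exp (-(s * u))
          ∂(condDistrib (fun ω => (I ω).toReal) (CV2X.dists Y m) P x)
        = CV2X.zeta lam mu Pd alpha s (x last)) ∧
    IntegrableOn (fun x => CV2X.zeta lam mu Pd alpha (CV2X.jArg mu t Pd alpha x) (x last)
        * Real.exp (-(CV2X.jArg mu t Pd alpha x * sig2)) * f x) (CV2X.orderedRegion m) ∧
    P.real {ω | ENNReal.ofReal t < CV2X.sinr Pd alpha sig2 Y G g m ω}
      = ∫ x in CV2X.orderedRegion m,
          CV2X.zeta lam mu Pd alpha (CV2X.jArg mu t Pd alpha x) (x last)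
            * Real.exp (-(CV2X.jArg mu t Pd alpha x * sig2)) * f x := by
  intro Y lam I last f
  have := isProbabilityMeasure_expMeasure hmu
  have hlam : 0 < lam := CV2X.lamD_pos hlamd
  have hY : CV2X.IsRadialPoisson P (2 * lam) (expMeasure mu) Y G :=
    hnet.isRadialPoisson hlamd.le hmu alpha
  obtain ⟨k, rfl⟩ := Nat.exists_eq_add_one.2 hm
  refine ⟨hY.hasLaw_dists (k + 1),
    (CV2X.measurable_interference hY.measurable_Y hY.measurable_G Pd alpha (k + 1)).aemeasurable,
    hY.ae_interference_lt_top hmu hPd.le halpha hm,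
    (CV2X.ae_distLaw_iff hY.pos).1 (hY.ae_integral_condInterference hmu hPd.le halpha hm),
    (CV2X.integrable_distLaw_iff hY.pos.le).1
      (CV2X.integrable_condCoverage hlam hmu hPd.le hsig2 ht hm), ?_⟩
  exact (hnet.measureReal_lt_sinr hlamd hmu hPd halpha hsig2 ht hm).trans
    (CV2X.integral_distLaw hY.pos.le _)

theorem theorem1 {Ω : Type*} [MeasurableSpace Ω] (P : Measure Ω) [IsProbabilityMeasure P]
    (m : ℕ) (hm : 0 < m)
    (lamd mu Pd alpha sig2 w t : ℝ) (v : ℝ≥0)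
    (hlamd : 0 < lamd) (hmu : 0 < mu) (hPd : 0 < Pd) (halpha : 2 < alpha)
    (hsig2 : 0 ≤ sig2) (ht : 0 ≤ t)
    (X chi G : ℕ → Ω → ℝ) (g : Ω → ℝ)
    (hnet : CV2X.IsDownlink P lamd mu w v X chi G g) :
    let Y : ℕ → Ω → ℝ := CV2X.displaced alpha X chi
    let lam : ℝ := CV2X.lamD lamd alpha w v
    let I : Ω → ℝ≥0∞ := CV2X.interference Pd alpha Y G m
    let last : Fin m := ⟨m - 1, Nat.sub_one_lt_of_lt hm⟩
    let f : (Fin m → ℝ) → ℝ := fun x => CV2X.jointDensity lam m (x last)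
    -- `f` on the ordered region is the joint density of the `m` smallest distances
    HasLaw (CV2X.dists Y m)
      ((volume.restrict (CV2X.orderedRegion m)).withDensity (fun x => ENNReal.ofReal (f x))) P ∧
    -- the interference is a finite random variable, and its Laplace transform given the
    -- distances `x_1, …, x_m` is `zeta`
    AEMeasurable I P ∧ (∀ᵐ ω ∂P, I ω < ∞) ∧
    (∀ᵐ x ∂(volume.restrict (CV2X.orderedRegion m)), ∀ s : ℝ, 0 ≤ s →
      ∫ u, Real.exp (-(s * u))
          ∂(condDistrib (fun ω => (I ω).toReal) (CV2X.dists Y m) P x)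
        = CV2X.zeta lam mu Pd alpha s (x last)) ∧
    -- the coverage probability
    IntegrableOn (fun x => CV2X.zeta lam mu Pd alpha (CV2X.jArg mu t Pd alpha x) (x last)
        * Real.exp (-(CV2X.jArg mu t Pd alpha x * sig2)) * f x) (CV2X.orderedRegion m) ∧
    P.real {ω | ENNReal.ofReal t < CV2X.sinr Pd alpha sig2 Y G g m ω}
      = ∫ x in CV2X.orderedRegion m,
          CV2X.zeta lam mu Pd alpha (CV2X.jArg mu t Pd alpha x) (x last)
            * Real.exp (-(CV2X.jArg mu t Pd alpha x * sig2)) * f x := by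
  exact theorem1_general P m hm lamd mu Pd alpha sig2 w t v hlamd hmu hPd
    (one_lt_two.trans halpha) hsig2 ht X chi G g hnet
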